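/- Let $\Sigma$ be a finite set, $\mathcal R$ a reflexive and symmetric relation on $\Sigma$, and let $\mathcal M=\langle\Sigma\mid ab=ba \text{ for }(a,b)\notin\mathcal R\rangle$ be the trace monoid. For $S\subseteq\Sigma$ let $\mathcal M_S$ be the submonoid generated by $S$. For $x\in\mathcal M$ let $|x|$ be its length and $|x|_a$ the number of occurrences of $a\in\Sigma$ in $x$. The heap of $x$ is the following labelled partial order: choose a word $w_1\cdots w_n$ representing $x$, take the pieces $1,\dots,n$ with labels $w_1,\dots,w_n$, and the order generated by $i\le j$ whenever $i<j$ and $(w_i,w_j)\in\mathcal R$; up to isomorphism it depends only on $x$. Write $\max(x)\subseteq U$ if all the maximal pieces of the heap of $x$ have their label in $U$. Let $\mathrm{Lk}(a)=\{b:(a,b)\in\mathcal R\}$. A trace is $a$-pyramidal if it is the trace of the sub-heap of all pieces below or equal to the lowest piece labelled $a$, in the heap of some $x$ with $|x|_a>0$. Let $\mu_S(X)=\sum_\gamma(-1)^{|\gamma|}X^{|\gamma|}$, where $\gamma$ ranges over the subsets of $S$ whose distinct elements are pairwise not related by $\mathcal R$. Let $p_S$ be the root of smallest modulus of $\mu_S$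 (it is real and positive) if $S\ne\emptyset$, and let $p_\emptyset=+\infty$. For $0<p<p_S$ let $B_{S,p}$ be the probability distribution on $\mathcal M_S$ given by $B_{S,p}(\{x\})=\mu_S(p)\,p^{|x|}$. Let $T\subseteq\Sigma$, $a_1\in T$, $p\in(0,p_\Sigma)$, $\Sigma'=\Sigma\setminus\{a_1\}$ and $r=1-\mu_\Sigma(p)/\mu_{\Sigma'}(p)$. Then $p<p_{\Sigma'}$, so that $B_{\Sigma',p}$ is a well-defined probability distribution; $r\in(0,1)$; and $r=B_{\Sigma,p}(|\xi|_{a_1}>0)$. Every $x\in\mathcal M$ can be written in a unique way as $x=u_0\cdots u_k$ with $k=|x|_{a_1}$, with $u_0,\dots,u_{k-1}$ being $a_1$-pyramidal and $u_k\in\mathcal M_{\Sigma'}$; and every $a_1$-pyramidal $u$ is $u=v\cdot a_1$ for a unique $v\in\mathcal M_{\Sigma'}$. Moreover: (1) Let $\xi$ be a random element of $\mathcal M$ distributed according to $B_{\Sigma,p}$ conditioned on $\{\max(\xi)\subseteq T\}$. Let $K=|\xi|_{a_1}$, let $\xi=U_0\cdots U_K$ be the above decomposition of $\xi$, and let $U_i=V_i\cdot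 a_1$ with $V_i\in\mathcal M_{\Sigma'}$ for $i<K$. Then $\mathbb P(K=k)=(1-r)r^k$ for every integer $k\ge0$. For every $k\geq 0$, conditionally on $\{K=k\}$: the variables $U_0,\dots,U_k$ are independent; $U_0,\dots,U_{k-1}$ are identically distributed; each of $V_0,\dots,V_{k-1}$ has the law $B_{\Sigma',p}$ conditioned on $\{\max(\cdot)\subseteq\mathrm{Lk}(a_1)\}$; and $U_k$ has the law $B_{\Sigma',p}$ conditioned on $\{\max(\cdot)\subseteq T\}$. (2) Conversely, let $K$ be a random integer with $\mathbb P(K=k)=(1-r)r^k$ for every $k\ge0$, and suppose that for every $k\ge0$, conditionally on $\{K=k\}$, the variables $V_0,\dots,V_{k-1},U$ are independent, each $V_i$ has the law $B_{\Sigma',p}$ conditioned on $\{\max(\cdot)\subseteq\mathrm{Lk}(a_1)\}$, and $U$ has the law $B_{\Sigma',p}$ conditioned on $\{\max(\cdot)\subseteq T\}$. Then $\xi=(V_0\cdot a_1)\cdots(V_{K-1}\cdot a_1)\cdot U$ is distributed according to $B_{\Sigma,p}$ conditioned on $\{\max(\xi)\subseteq T\}$. -/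

import Mathlib

open MeasureTheory ProbabilityTheory
open scoped ENNReal

noncomputable section

/-- The defining relations `ab = ba` for `(a, b) ∉ R`. -/
inductive CommRel {α : Type*} (R : α → α → Prop) : FreeMonoid α → FreeMonoid α → Prop
  | swap (a b : α) (h : ¬ R a b) :
      CommRel R (FreeMonoid.of a * FreeMonoid.of b) (FreeMonoid.of b * FreeMonoid.of a)

/-- The trace monoid `⟨α | ab = ba for (a, b) ∉ R⟩`. -/
def TraceMonoid {α : Type*} (R : α → α → Prop) : Type _ := PresentedMonoid (CommRel R)

namespace TraceMonoid

variable {α : Type*} (R : α → α → Prop)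

instance : Monoid (TraceMonoid R) := inferInstanceAs (Monoid (PresentedMonoid (CommRel R)))

/-- Traces form a discrete space. -/
instance : MeasurableSpace (TraceMonoid R) := ⊤

/-- The class of a word. -/
def ofWord (w : List α) : TraceMonoid R :=
  PresentedMonoid.mk (CommRel R) (FreeMonoid.ofList w)

/-- A letter, as a trace. -/
def letter (a : α) : TraceMonoid R := ofWord R [a]

/-- The multiset of the letters of a trace. -/
def letters : TraceMonoid R →* Multiplicative (Multiset α) :=
  PresentedMonoid.lift (rels := CommRel R) (fun a => Multiplicative.ofAdd {a}) (by
    rintro _ _ ⟨a, b, _⟩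
    simp only [map_mul, FreeMonoid.lift_eval_of]
    exact mul_comm _ _)

/-- The length `|x|` of a trace. -/
def length (x : TraceMonoid R) : ℕ := Multiset.card (Multiplicative.toAdd (letters R x))

open Classical in
/-- The number `|x|_a` of occurrences of the letter `a` in a trace. -/
def occ (a : α) (x : TraceMonoid R) : ℕ :=
  Multiset.count a (Multiplicative.toAdd (letters R x))

/-- The submonoid generated by a set of letters. -/
def sub (S : Set α) : Submonoid (TraceMonoid R) := Submonoid.closure (letter R '' S)

/-- The order of the heap of a word: the pieces are the positions of the word, labelled by the
letters there, and the order is generated by `i ≤ j` whenever `i < j` and the labels of `i` and `j`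
are related by `R`. -/
def HeapLE (w : List α) : Fin w.length → Fin w.length → Prop :=
  Relation.ReflTransGen fun i j => i < j ∧ R (w.get i) (w.get j)

/-- `max(x) ⊆ U`: all the maximal pieces of the heap of `x` have their label in `U`. (All the words
that represent `x` have isomorphic heaps.) -/
def MaxIn (U : Set α) (x : TraceMonoid R) : Prop :=
  ∀ w : List α, ofWord R w = x →
    ∀ i : Fin w.length, (∀ j, HeapLE R w i j → j = i) → w.get i ∈ U

/-- The link of a letter. -/
def link (a : α) : Set α := {b | R a b}

open Classical in
/-- The trace of the sub-heap of the pieces that are below the piece `i`. -/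
def below (w : List α) (i : Fin w.length) : TraceMonoid R :=
  ofWord R (((List.finRange w.length).filter fun j => HeapLE R w j i).map w.get)

/-- The `a`-pyramidal traces: those obtained from a trace (represented by a word `w`) in which `a`
occurs, as the sub-heap of the pieces below the first (lowest) piece `i` labelled `a`. -/
def pyr (a : α) : Set (TraceMonoid R) :=
  {y | ∃ (w : List α) (i : Fin w.length),
    w.get i = a ∧ (∀ j < i, w.get j ≠ a) ∧ y = below R w i}

/-- `x = u₀ ⋯ u_k` with `u₀, …, u_{k-1}` being `a`-pyramidal and `u_k` without the letter `a`. -/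
structure IsPyrDecomp (a : α) (x : TraceMonoid R) (k : ℕ) (u : Fin (k + 1) → TraceMonoid R) :
    Prop where
  pyramidal : ∀ i : Fin k, u i.castSucc ∈ pyr R a
  remainder : u (Fin.last k) ∈ sub R {a}ᶜ
  prod_eq : (List.ofFn u).prod = x

variable [Fintype α]

open Classical in
/-- The Möbius polynomial of the trace monoid on a set `S` of letters: the sum of
`(-1)^|γ| X^|γ|` over the cliques, i.e. the sets `γ ⊆ S` of pairwise commuting letters. -/
def mobius (S : Set α) : Polynomial ℤ :=
  ∑ γ ∈ Finset.univ.filter fun γ : Finset α =>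
      (∀ a ∈ γ, a ∈ S) ∧ ∀ a ∈ γ, ∀ b ∈ γ, a ≠ b → ¬ R a b,
    (-1) ^ γ.card * Polynomial.X ^ γ.card

/-- The value `μ_S(p)` of the Möbius polynomial. -/
def mobiusAt (S : Set α) (p : ℝ) : ℝ := Polynomial.aeval p (mobius R S)

/-- The root `p_S` of smallest modulus of the Möbius polynomial, given as the smallest modulus of a
complex root; it is `⊤` if `S = ∅`, where the polynomial is `1`. -/
def smallestRoot (S : Set α) : ℝ≥0∞ :=
  ⨅ (z : ℂ) (_ : Polynomial.aeval z (mobius R S) = 0), ‖z‖ₑ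

/-- The multiplicative probability `B_{S,p}`, which gives mass `μ_S(p) p^|x|` to each trace `x` on
the letters of `S`, as a measure on the whole trace monoid. -/
def multMeasure (S : Set α) (p : ℝ) : Measure (TraceMonoid R) :=
  Measure.sum fun x : sub R S =>
    ENNReal.ofReal (mobiusAt R S p * p ^ length R (x : TraceMonoid R)) •
      Measure.dirac (x : TraceMonoid R)

/-- `B_{S,p}` conditioned on `max(·) ⊆ T`. -/
def condMeasure (S : Set α) (p : ℝ) (T : Set α) : Measure (TraceMonoid R) :=
  (multMeasure R S p)[|{x | MaxIn R T x}]

end TraceMonoid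

end

/-! Take off from a trace the smallest left factor that contains `a`, and repeat until no `a` is
left. Each factor is a pyramid `v · a` with `max(v) ⊆ link a`, the remainder avoids `a`, and these
factors are unique (`exists_pyramid_mul`, `pyramid_mul_inj`). Lengths add up along the product, and
because `a ∈ T` the condition `max ⊆ T` bears on the remainder alone. So the weight `p^|x|`
restricted to `max(x) ⊆ T` is a product of weights of the factors (`rawMeasure_pyrProd`).

Let `q` be the total weight of the pyramids (`pyrMass`) and `C` that of the remainders. Traces with
`k` letters `a` weigh `q^k C`, and all traces weigh `C / (1 - q)`. After normalisation, the number
of factors is geometric of parameter `q` and, given this number, the factors are independent. The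
resulting identity of measures, `condMeasure_restrict_occ`, yields both the decomposition and the
reconstruction.

It remains to see that `q = r`. By Möbius inversion (`mobius_mul_genSeries`) the total weight of the
traces on `S` is `1 / μ_S(p)`, where convergence for `p < p_S` comes from the holomorphy of `1 /
μ_S` (`summable_of_lt_smallestRoot`). With no condition on the maximal pieces, the weight identity
reads `1 / μ_Σ = (1 - q)⁻¹ / μ_Σ'`.

The combinatorics rests on a solution of the word problem, `ofWord_eq_iff`: a trace is determined by
its projections to the pairs of related letters. Cancellation and Levi's lemma follow. -/

namespace TraceMonoid

/-! ### The word problem, divisibility and Levi's lemma in trace monoids. -/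

section Words

variable {α : Type*} {R : α → α → Prop}

theorem ofWord_nil : ofWord R [] = 1 := rfl

theorem ofWord_append (s t : List α) : ofWord R (s ++ t) = ofWord R s * ofWord R t := rfl

theorem ofWord_cons (c : α) (t : List α) : ofWord R (c :: t) = letter R c * ofWord R t := rfl

theorem ofWord_concat (t : List α) (c : α) : ofWord R (t ++ [c]) = ofWord R t * letter R c := rfl

theorem ofWord_surjective : Function.Surjective (ofWord R) := by
  intro x
  obtain ⟨w, hw⟩ := Quotient.exists_rep (s := (conGen (CommRel R)).toSetoid) x
  exact ⟨FreeMonoid.toList w, hw⟩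

theorem letter_comm {a b : α} (h : ¬ R a b) : letter R a * letter R b = letter R b * letter R a :=
  (Con.eq _).2 (ConGen.Rel.of _ _ (CommRel.swap a b h))

theorem letters_ofWord (w : List α) : (letters R (ofWord R w)).toAdd = (w : Multiset α) := by
  induction w with
  | nil => rfl
  | cons c t ih =>
    rw [ofWord_cons, map_mul, toAdd_mul, ih]
    rfl

theorem letter_comm_ofWord {c : α} {w : List α} (h : ∀ b ∈ w, ¬ R c b) :
    letter R c * ofWord R w = ofWord R w * letter R c := by
  induction w with
  | nil => simp [ofWord_nil]
  | cons b t ih =>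
    rw [ofWord_cons, ← mul_assoc, letter_comm (h b (by simp)), mul_assoc,
      ih fun d hd => h d (by simp [hd]), mul_assoc]

/-- The set of letters of a trace. -/
def supp (x : TraceMonoid R) : Set α := {c | c ∈ (letters R x).toAdd}

theorem mem_supp_ofWord {w : List α} {c : α} : c ∈ supp (ofWord R w) ↔ c ∈ w := by
  simp [supp, letters_ofWord]

theorem supp_one : supp (1 : TraceMonoid R) = ∅ := by
  ext c; simp [← ofWord_nil, mem_supp_ofWord]

theorem supp_mul (x y : TraceMonoid R) : supp (x * y) = supp x ∪ supp y := by
  ext c; simp [supp]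

theorem supp_letter (c : α) : supp (letter R c) = {c} := by
  ext d; simp [letter, mem_supp_ofWord]

theorem length_one : length R 1 = 0 := by simp [length]

theorem length_mul (x y : TraceMonoid R) : length R (x * y) = length R x + length R y := by
  simp [length]

theorem length_ofWord (w : List α) : length R (ofWord R w) = w.length := by
  simp [length, letters_ofWord]

theorem length_letter (c : α) : length R (letter R c) = 1 := length_ofWord [c]

theorem occ_one (a : α) : occ R a 1 = 0 := by simp [occ]

theorem occ_mul (a : α) (x y : TraceMonoid R) : occ R a (x * y) = occ R a x + occ R a y := by
  simp [occ]

theorem occ_letter_self (a : α) : occ R a (letter R a) = 1 := by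
  simp [occ, letter, letters_ofWord]

theorem occ_pos_iff {a : α} {x : TraceMonoid R} : 0 < occ R a x ↔ a ∈ supp x := by
  simp [occ, supp, Multiset.count_pos]

theorem occ_eq_zero_iff {a : α} {x : TraceMonoid R} : occ R a x = 0 ↔ a ∉ supp x := by
  rw [← occ_pos_iff]; omega

theorem mem_sub_iff {S : Set α} {x : TraceMonoid R} : x ∈ sub R S ↔ supp x ⊆ S := by
  constructor
  · intro h
    induction h using Submonoid.closure_induction with
    | mem x hx => obtain ⟨c, hc, rfl⟩ := hx; simpa [supp_letter] using hc
    | one => simp [supp_one]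
    | mul x y _ _ hx hy => rw [supp_mul]; exact Set.union_subset hx hy
  · obtain ⟨w, rfl⟩ := ofWord_surjective x
    induction w with
    | nil => intro _; exact one_mem _
    | cons c t ih =>
      intro h
      rw [ofWord_cons, supp_mul, supp_letter, Set.union_subset_iff, Set.singleton_subset_iff] at h
      exact mul_mem (Submonoid.subset_closure (Set.mem_image_of_mem _ h.1)) (ih h.2)

theorem mem_sub_compl_iff {a : α} {x : TraceMonoid R} : x ∈ sub R {a}ᶜ ↔ a ∉ supp x := by
  rw [mem_sub_iff, Set.subset_compl_singleton_iff]

theorem mem_sub_univ (x : TraceMonoid R) : x ∈ sub R Set.univ :=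
  mem_sub_iff.2 (Set.subset_univ _)

open Classical in
/-- The projection of a word to the letters `a` and `b`. -/
noncomputable def pairProj (a b : α) (w : List α) : List α := w.filter fun c => c = a ∨ c = b

theorem pairProj_append (a b : α) (s t : List α) :
    pairProj a b (s ++ t) = pairProj a b s ++ pairProj a b t := List.filter_append ..

theorem pairProj_reverse (a b : α) (w : List α) :
    pairProj a b w.reverse = (pairProj a b w).reverse := by
  simp [pairProj, List.filter_reverse]

/-- Erasing the letters other than `a` and `b` respects the defining relations: two distinct
commuting letters cannot both survive, since `a` and `b` are related. The projection is thus a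
morphism from the trace monoid to a free monoid. -/
theorem pairProj_eq_of_ofWord_eq (hsymm : ∀ a b, R a b → R b a) {w w' : List α}
    (h : ofWord R w = ofWord R w') {a b : α} (hab : R a b) : pairProj a b w = pairProj a b w' := by
  classical
  let f : α → FreeMonoid α := fun c => if c = a ∨ c = b then FreeMonoid.of c else 1
  let F : PresentedMonoid (CommRel R) →* FreeMonoid α := PresentedMonoid.lift f (by
    rintro _ _ ⟨c, d, hcd⟩
    simp only [map_mul, FreeMonoid.lift_eval_of, f]
    by_cases hc : c = a ∨ c = b <;> by_cases hd : d = a ∨ d = b <;> simp only [hc, hd, if_true,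
      if_false, one_mul, mul_one]
    rcases hc with rfl | rfl <;> rcases hd with rfl | rfl
    · rfl
    · exact absurd hab hcd
    · exact absurd (hsymm _ _ hab) hcd
    · rfl)
  have key : ∀ w : List α, FreeMonoid.toList (F (ofWord R w)) = pairProj a b w := by
    intro w
    induction w with
    | nil => rfl
    | cons c t ih =>
      have h1 : F (ofWord R (c :: t)) = f c * F (ofWord R t) := by
        rw [ofWord_cons]
        exact (map_mul F _ _).trans (congrArg (· * _) (PresentedMonoid.lift_of _ _))
      rw [h1, FreeMonoid.toList_mul, ih]
      by_cases hc : c = a ∨ c = b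
      · simp [f, hc, pairProj]
      · simp [f, hc, pairProj]
  rw [← key, ← key, h]

/-- If the projections of `w` and `c :: t` agree, then the first `c` of `w` commutes with what
precedes it. -/
theorem exists_eq_append_cons_of_pairProj (hrefl : ∀ a, R a a) {c : α} {t w : List α}
    (h : ∀ a b, R a b → pairProj a b (c :: t) = pairProj a b w) :
    ∃ s u, w = s ++ c :: u ∧ ∀ b ∈ s, ¬ R c b := by
  classical
  have hc : c ∈ w := by
    have : c ∈ pairProj c c (c :: t) := by simp [pairProj]
    rw [h c c (hrefl c)] at this
    exact (List.mem_filter.1 this).1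
  obtain ⟨s, u, hcs, rfl, -⟩ := List.exists_erase_eq hc
  refine ⟨s, u, rfl, fun b hb hR => ?_⟩
  -- The projection to `c` and `b` starts with `c`; if `b` is in `s`, this first letter already lies
  -- in `s`, which has no `c`.
  have h1 := h c b hR
  rw [pairProj_append] at h1
  have h2 : pairProj c b (c :: t) = c :: pairProj c b t := by simp [pairProj]
  rw [h2] at h1
  have hb' : b ∈ pairProj c b s := List.mem_filter.2 ⟨hb, by simp⟩
  cases hs : pairProj c b s with
  | nil => simp [hs] at hb'
  | cons d l =>
    rw [hs, List.cons_append, List.cons.injEq] at h1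
    have : c ∈ pairProj c b s := by rw [hs, h1.1]; simp
    exact hcs (List.mem_filter.1 this).1

theorem ofWord_append_cons_of_comm {s u : List α} {c : α} (h : ∀ b ∈ s, ¬ R c b) :
    ofWord R (s ++ c :: u) = ofWord R (c :: (s ++ u)) := by
  rw [ofWord_append, ofWord_cons, ofWord_cons, ofWord_append, ← mul_assoc, ← mul_assoc,
    letter_comm_ofWord h]

/-- The first letter of one word can be brought to the front of the other; removing it from both
leaves equal projections. -/
theorem ofWord_eq_of_pairProj_eq (hrefl : ∀ a, R a a) (hsymm : ∀ a b, R a b → R b a)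
    {w w' : List α} (h : ∀ a b, R a b → pairProj a b w = pairProj a b w') :
    ofWord R w = ofWord R w' := by
  classical
  induction w generalizing w' with
  | nil =>
    cases w' with
    | nil => rfl
    | cons c t => simpa [pairProj] using h c c (hrefl c)
  | cons c t ih =>
    obtain ⟨s, u, rfl, hs⟩ := exists_eq_append_cons_of_pairProj hrefl h
    have hw := ofWord_append_cons_of_comm (u := u) hs
    rw [hw, ofWord_cons, ofWord_cons, ih]
    intro a b hab
    have h1 := h a b hab
    rw [pairProj_eq_of_ofWord_eq hsymm hw hab] at h1
    rw [← List.singleton_append, pairProj_append, ← List.singleton_append (l := s ++ u),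
      pairProj_append] at h1
    exact List.append_cancel_left h1

theorem ofWord_eq_iff (hrefl : ∀ a, R a a) (hsymm : ∀ a b, R a b → R b a) {w w' : List α} :
    ofWord R w = ofWord R w' ↔ ∀ a b, R a b → pairProj a b w = pairProj a b w' :=
  ⟨fun h _ _ hab => pairProj_eq_of_ofWord_eq hsymm h hab, ofWord_eq_of_pairProj_eq hrefl hsymm⟩

/-- This carries statements about left divisors over to right divisors. -/
theorem ofWord_reverse_eq_iff (hrefl : ∀ a, R a a) (hsymm : ∀ a b, R a b → R b a)
    {w w' : List α} : ofWord R w.reverse = ofWord R w'.reverse ↔ ofWord R w = ofWord R w' := by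
  simp only [ofWord_eq_iff hrefl hsymm, pairProj_reverse, List.reverse_inj]

/-- The projections take values in free monoids, which are cancellative. -/
theorem mul_left_cancel_trace (hrefl : ∀ a, R a a) (hsymm : ∀ a b, R a b → R b a)
    {x y z : TraceMonoid R} (h : x * y = x * z) : y = z := by
  obtain ⟨u, rfl⟩ := ofWord_surjective x
  obtain ⟨v, rfl⟩ := ofWord_surjective y
  obtain ⟨w, rfl⟩ := ofWord_surjective z
  rw [← ofWord_append, ← ofWord_append, ofWord_eq_iff hrefl hsymm] at h
  rw [ofWord_eq_iff hrefl hsymm]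
  intro a b hab
  have := h a b hab
  rw [pairProj_append, pairProj_append] at this
  exact List.append_cancel_left this

theorem mul_right_cancel_trace (hrefl : ∀ a, R a a) (hsymm : ∀ a b, R a b → R b a)
    {x y z : TraceMonoid R} (h : y * x = z * x) : y = z := by
  obtain ⟨u, rfl⟩ := ofWord_surjective x
  obtain ⟨v, rfl⟩ := ofWord_surjective y
  obtain ⟨w, rfl⟩ := ofWord_surjective z
  rw [← ofWord_append, ← ofWord_append, ofWord_eq_iff hrefl hsymm] at h
  rw [ofWord_eq_iff hrefl hsymm]
  intro a b hab
  have := h a b hab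
  rw [pairProj_append, pairProj_append] at this
  exact List.append_cancel_right this

/-- A letter that divides a word on the left occurs in it after letters that commute with it. -/
theorem exists_append_of_ofWord_eq_letter_mul (hrefl : ∀ a, R a a)
    (hsymm : ∀ a b, R a b → R b a) {w : List α} {c : α} {y : TraceMonoid R}
    (h : ofWord R w = letter R c * y) : ∃ s u, w = s ++ c :: u ∧ ∀ b ∈ s, ¬ R c b := by
  obtain ⟨t, rfl⟩ := ofWord_surjective y
  rw [← ofWord_cons] at h
  exact exists_eq_append_cons_of_pairProj hrefl ((ofWord_eq_iff hrefl hsymm).1 h.symm)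

/-- A letter that divides a word on the right occurs in it before letters that commute with it. -/
theorem exists_append_of_ofWord_eq_mul_letter (hrefl : ∀ a, R a a)
    (hsymm : ∀ a b, R a b → R b a) {w : List α} {c : α} {y : TraceMonoid R}
    (h : ofWord R w = y * letter R c) : ∃ s u, w = s ++ c :: u ∧ ∀ b ∈ u, ¬ R c b := by
  obtain ⟨t, rfl⟩ := ofWord_surjective y
  rw [← ofWord_concat, ← ofWord_reverse_eq_iff hrefl hsymm, List.reverse_append] at h
  obtain ⟨s, u, hw, hs⟩ := exists_append_of_ofWord_eq_letter_mul hrefl hsymm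
    (h.trans (ofWord_cons c t.reverse))
  refine ⟨u.reverse, s.reverse, ?_, by simpa using hs⟩
  rw [← List.reverse_reverse w, hw]
  simp

theorem letter_comm_of_supp {c : α} {x : TraceMonoid R} (h : ∀ b ∈ supp x, ¬ R c b) :
    letter R c * x = x * letter R c := by
  obtain ⟨w, rfl⟩ := ofWord_surjective x
  exact letter_comm_ofWord fun b hb => h b (mem_supp_ofWord.2 hb)

/-- A letter that divides a product on the left divides the first factor, or it commutes with it
and divides the second one. -/
theorem letter_dvd_mul (hrefl : ∀ a, R a a) (hsymm : ∀ a b, R a b → R b a) {c : α}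
    {x y z : TraceMonoid R} (h : x * y = letter R c * z) :
    (∃ x', x = letter R c * x') ∨ (∀ b ∈ supp x, ¬ R c b) ∧ ∃ y', y = letter R c * y' := by
  obtain ⟨u, rfl⟩ := ofWord_surjective x
  obtain ⟨v, rfl⟩ := ofWord_surjective y
  rw [← ofWord_append] at h
  obtain ⟨s, t, hw, hs⟩ := exists_append_of_ofWord_eq_letter_mul hrefl hsymm h
  -- The cases tell on which side of the cut between `u` and `v` the letter `c` falls.
  rcases List.append_eq_append_iff.1 hw with ⟨l, h1, h2⟩ | ⟨l, h1, h2⟩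
  · right
    refine ⟨fun b hb => hs b ?_, ofWord R (l ++ t), ?_⟩
    · rw [h1]; exact List.mem_append_left _ (mem_supp_ofWord.1 hb)
    · rw [h2, ← ofWord_cons, ofWord_append_cons_of_comm]
      intro b hb; exact hs b (by rw [h1]; exact List.mem_append_right _ hb)
  · cases l with
    | nil =>
      rw [List.append_nil] at h1
      rw [List.nil_append] at h2
      right
      refine ⟨fun b hb => hs b (h1 ▸ mem_supp_ofWord.1 hb), ofWord R t, ?_⟩
      rw [← h2]; rfl
    | cons d l =>
      rw [List.cons_append, List.cons.injEq] at h2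
      left
      refine ⟨ofWord R (s ++ l), ?_⟩
      rw [h1, ← h2.1, ← ofWord_cons, ofWord_append_cons_of_comm hs]

/-- A letter that divides a product on the right divides the second factor, or it commutes with it
and divides the first one. -/
theorem dvd_mul_letter (hrefl : ∀ a, R a a) (hsymm : ∀ a b, R a b → R b a) {c : α}
    {x y z : TraceMonoid R} (h : x * y = z * letter R c) :
    (∃ y', y = y' * letter R c) ∨ (∀ b ∈ supp y, ¬ R c b) ∧ ∃ x', x = x' * letter R c := by
  obtain ⟨u, rfl⟩ := ofWord_surjective x
  obtain ⟨v, rfl⟩ := ofWord_surjective y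
  obtain ⟨w, rfl⟩ := ofWord_surjective z
  rw [← ofWord_append, ← ofWord_concat, ← ofWord_reverse_eq_iff hrefl hsymm, List.reverse_append,
    List.reverse_append, ofWord_append] at h
  have key : ∀ {u : List α}, (∃ y, ofWord R u.reverse = letter R c * y) →
      ∃ y, ofWord R u = y * letter R c := by
    rintro u ⟨y, hy⟩
    obtain ⟨t, rfl⟩ := ofWord_surjective y
    refine ⟨ofWord R t.reverse, ?_⟩
    rw [← ofWord_concat, ← ofWord_reverse_eq_iff hrefl hsymm, hy]
    simp [ofWord_cons]
  rcases letter_dvd_mul hrefl hsymm (h.trans (ofWord_cons c w.reverse)) with h | ⟨h1, h2⟩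
  · exact Or.inl (key h)
  · refine Or.inr ⟨fun b hb => h1 b ?_, key h2⟩
    rw [mem_supp_ofWord] at hb ⊢
    simpa using hb

/-- Levi's lemma. -/
theorem levi (hrefl : ∀ a, R a a) (hsymm : ∀ a b, R a b → R b a) {x y z t : TraceMonoid R}
    (h : x * y = z * t) : ∃ p q r s : TraceMonoid R, x = p * q ∧ y = r * s ∧ z = p * r ∧
      t = q * s ∧ ∀ b ∈ supp q, ∀ c ∈ supp r, ¬ R b c := by
  obtain ⟨w, rfl⟩ := ofWord_surjective x
  induction w generalizing z t with
  | nil =>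
    refine ⟨1, 1, z, t, by simp [ofWord_nil], by simpa [ofWord_nil] using h, by simp, by simp, ?_⟩
    simp [supp_one]
  | cons c w ih =>
    rw [ofWord_cons, mul_assoc] at h
    -- The first letter of `x` either divides `z`, and joins `p`, or commutes with all of `z` and
    -- divides `t`, and joins `q`.
    rcases letter_dvd_mul hrefl hsymm h.symm with ⟨z', rfl⟩ | ⟨hc, t', rfl⟩
    · rw [mul_assoc] at h
      obtain ⟨p, q, r, s, h1, h2, h3, h4, h5⟩ := ih (mul_left_cancel_trace hrefl hsymm h)
      exact ⟨letter R c * p, q, r, s, by rw [ofWord_cons, h1, mul_assoc], h2,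
        by rw [h3, mul_assoc], h4, h5⟩
    · rw [← mul_assoc z, ← letter_comm_of_supp hc, mul_assoc] at h
      obtain ⟨p, q, r, s, h1, h2, h3, h4, h5⟩ := ih (mul_left_cancel_trace hrefl hsymm h)
      rw [h3, supp_mul] at hc
      refine ⟨p, letter R c * q, r, s, ?_, h2, h3, by rw [h4, mul_assoc], ?_⟩
      · rw [ofWord_cons, h1, ← mul_assoc, ← mul_assoc,
          letter_comm_of_supp fun b hb => hc b (Or.inl hb)]
      · rw [supp_mul, supp_letter]
        rintro b (rfl | hb) d hd
        · exact hc d (Or.inr hd)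
        · exact h5 b hb d hd

end Words

/-! ### Maximal pieces, pyramids and the decomposition of a trace. -/

section Heaps

variable {α : Type*} {R : α → α → Prop}

theorem HeapLE.le {w : List α} {i j : Fin w.length} (h : HeapLE R w i j) : i ≤ j := by
  induction h with
  | refl => exact le_rfl
  | tail _ h ih => exact ih.trans h.1.le

/-- Such a piece commutes with all that follows it, so it can be moved to the end of the word. -/
theorem ofWord_eq_mul_letter_get {w : List α} {i : Fin w.length}
    (h : ∀ j, i < j → ¬ R (w.get i) (w.get j)) :
    ∃ y, ofWord R w = y * letter R (w.get i) := by
  refine ⟨ofWord R (w.take i) * ofWord R (w.drop (i + 1)), ?_⟩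
  have hw : w = w.take i ++ w.get i :: w.drop (i + 1) := by simp
  rw [mul_assoc, ← letter_comm_ofWord, ← ofWord_cons, ← ofWord_append, ← hw]
  intro b hb
  obtain ⟨n, hn, rfl⟩ := List.mem_iff_getElem.1 hb
  rw [List.length_drop] at hn
  rw [List.getElem_drop]
  exact h ⟨i + 1 + n, by omega⟩ (by rw [Fin.lt_def]; simp only; omega)

/-- The labels of maximal pieces are the right divisors among the letters. Heaps can then be
replaced by divisibility. -/
theorem maxIn_iff {U : Set α} {x : TraceMonoid R} :
    MaxIn R U x ↔ ∀ c y, x = y * letter R c → c ∈ U := by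
  constructor
  · rintro h c y rfl
    obtain ⟨w, rfl⟩ := ofWord_surjective y
    have := h (w ++ [c]) (ofWord_concat w c) ⟨w.length, by simp⟩ (fun j hj => by
      have h1 := hj.le
      have h2 : j.1 < w.length + 1 := lt_of_lt_of_eq j.2 (by simp)
      rw [Fin.le_def] at h1
      ext
      simp only at h1 ⊢
      omega)
    simpa using this
  · rintro h w rfl i hi
    obtain ⟨y, hy⟩ := ofWord_eq_mul_letter_get (R := R) (i := i) fun j hij hR =>
      hij.ne' (hi j (Relation.ReflTransGen.single ⟨hij, hR⟩))
    exact h _ y hy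

theorem maxIn_univ (x : TraceMonoid R) : MaxIn R Set.univ x := fun _ _ _ _ => trivial

theorem maxIn_one (U : Set α) : MaxIn R U 1 := by
  refine maxIn_iff.2 fun c y h => ?_
  have := congrArg (length R) h
  rw [length_mul, length_letter, length_one] at this
  omega

/-- The lowest `a` comes last among the pieces below it and is their only `a`. A piece that is
maximal once this apex is removed must be directly related to the apex. -/
theorem exists_eq_mul_letter_of_mem_pyr (hrefl : ∀ a, R a a) (hsymm : ∀ a b, R a b → R b a)
    {a : α} {u : TraceMonoid R} (hu : u ∈ pyr R a) :
    ∃ v, a ∉ supp v ∧ MaxIn R (link R a) v ∧ u = v * letter R a := by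
  classical
  obtain ⟨w, i, hi, hlt, rfl⟩ := hu
  have hsort : ((List.finRange w.length).filter fun j => HeapLE R w j i).Pairwise (· < ·) :=
    (List.sortedLT_finRange _).pairwise.filter _
  have hmem : ∀ j, j ∈ ((List.finRange w.length).filter fun j => HeapLE R w j i) ↔
      HeapLE R w j i := by simp
  have hbelow : below R w i =
    ofWord R (((List.finRange w.length).filter fun j => HeapLE R w j i).map w.get) := by
    unfold below; congr
  rw [hbelow]
  generalize ((List.finRange w.length).filter fun j => HeapLE R w j i) = l at hsort hmem
  obtain ⟨l₁, l₂, rfl⟩ := List.append_of_mem ((hmem i).2 Relation.ReflTransGen.refl)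
  rw [List.pairwise_append, List.pairwise_cons] at hsort
  obtain ⟨hs1, ⟨hs2, -⟩, hs3⟩ := hsort
  have hl₂ : l₂ = [] := List.eq_nil_iff_forall_not_mem.2 fun j hj =>
    (hs2 j hj).not_ge ((hmem j).1 (by simp [hj])).le
  subst hl₂
  have hl₁ : ∀ j ∈ l₁, j < i := fun j hj => hs3 j hj i (by simp)
  refine ⟨ofWord R (l₁.map w.get), ?_, ?_, ?_⟩
  · rw [mem_supp_ofWord, List.mem_map]
    rintro ⟨j, hj, hja⟩
    exact hlt j (hl₁ j hj) hja
  · refine maxIn_iff.2 fun c y hy => ?_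
    obtain ⟨s, t, hst, ht⟩ := exists_append_of_ofWord_eq_mul_letter hrefl hsymm hy
    obtain ⟨m₁, m₂, rfl, -, hm₂⟩ := List.map_eq_append_iff.1 hst
    obtain ⟨j, m₃, rfl, rfl, hm₃⟩ := List.map_eq_cons_iff.1 hm₂
    have hji : j < i := hl₁ j (by simp)
    -- The first step of a chain from `j` up to `i` leads to a related piece `j'`. It cannot come
    -- before `j`, nor among the later pieces of `l₁`, all of which commute with `j`; hence `j' =
    -- i`.
    rcases Relation.ReflTransGen.cases_head ((hmem j).1 (by simp)) with h | ⟨j', ⟨hjj', hR⟩, h⟩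
    · exact absurd h hji.ne
    · have hj' := (hmem j').2 h
      rw [List.append_assoc, List.mem_append, List.cons_append, List.mem_cons, List.mem_append]
        at hj'
      rw [List.pairwise_append, List.pairwise_cons] at hs1
      rcases hj' with hj' | hj' | hj' | hj'
      · exact absurd (hs1.2.2 j' hj' j (by simp)) hjj'.not_gt
      · exact absurd hj' hjj'.ne'
      · exact absurd hR (ht _ (hm₃ ▸ List.mem_map_of_mem hj'))
      · rw [List.mem_singleton] at hj'
        subst hj'
        rw [hi] at hR
        exact hsymm _ _ hR
  · rw [List.map_append, ofWord_append, List.map_singleton, hi]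
    rfl

theorem mul_letter_mem_pyr (hsymm : ∀ a b, R a b → R b a) {a : α}
    {v : TraceMonoid R} (hv : a ∉ supp v) (hmax : MaxIn R (link R a) v) :
    v * letter R a ∈ pyr R a := by
  classical
  obtain ⟨w, rfl⟩ := ofWord_surjective v
  have hlen : (w ++ [a]).length = w.length + 1 := by simp
  let i : Fin (w ++ [a]).length := ⟨w.length, by simp⟩
  have hi : (w ++ [a]).get i = a := by simp [i]
  have hj : ∀ j : Fin (w ++ [a]).length, j < i → ∃ h : j.1 < w.length,
      (w ++ [a]).get j = w.get ⟨j, h⟩ := by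
    intro j hj
    have h : j.1 < w.length := hj
    exact ⟨h, by simp [h]⟩
  -- By induction from the end of the word, every piece is below the final `a`: one with no related
  -- piece after it would be maximal in `v`, hence related to `a`.
  have hall : ∀ n (j : Fin (w ++ [a]).length), w.length - j.1 = n → HeapLE R (w ++ [a]) j i := by
    intro n
    induction n using Nat.strong_induction_on with
    | _ n ih =>
      intro j hjn
      by_cases hji : j = i
      · rw [hji]; exact Relation.ReflTransGen.refl
      have hlt : j < i := lt_of_le_of_ne (by have := j.2; rw [Fin.le_def]; simp only [i]; omega) hji
      obtain ⟨hjw, hget⟩ := hj j hlt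
      by_contra hcon
      have hno : ∀ j', j < j' → ¬ R ((w ++ [a]).get j) ((w ++ [a]).get j') := by
        intro j' hjj' hR
        have : j.1 < j'.1 := hjj'
        exact hcon (Relation.ReflTransGen.head ⟨hjj', hR⟩ (ih _ (by omega) j' rfl))
      obtain ⟨y, hy⟩ := ofWord_eq_mul_letter_get (R := R) (w := w) (i := ⟨j, hjw⟩) (by
        intro j' hjj'
        have h1 := hno ⟨j', by have := j'.2; omega⟩ hjj'
        rw [hget] at h1
        simpa using h1)
      have h1 := maxIn_iff.1 hmax _ y hy
      have h2 := hno i hlt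
      rw [hget, hi] at h2
      exact h2 (hsymm _ _ h1)
  refine ⟨w ++ [a], i, hi, fun j hji => ?_, ?_⟩
  · obtain ⟨h, hget⟩ := hj j hji
    rw [hget]
    intro h'
    exact hv (mem_supp_ofWord.2 (h' ▸ List.get_mem _ _))
  · unfold below
    rw [List.filter_eq_self.2 fun j _ => by simpa using hall _ j rfl, ← ofWord_concat]
    congr 1
    simp

theorem mem_pyr_iff (hrefl : ∀ a, R a a) (hsymm : ∀ a b, R a b → R b a) {a : α}
    {u : TraceMonoid R} :
    u ∈ pyr R a ↔ ∃ v, a ∉ supp v ∧ MaxIn R (link R a) v ∧ u = v * letter R a := by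
  refine ⟨exists_eq_mul_letter_of_mem_pyr hrefl hsymm, ?_⟩
  rintro ⟨v, hv, hmax, rfl⟩
  exact mul_letter_mem_pyr hsymm hv hmax

theorem existsUnique_eq_mul_letter_of_mem_pyr (hrefl : ∀ a, R a a)
    (hsymm : ∀ a b, R a b → R b a) {a : α} {u : TraceMonoid R} (hu : u ∈ pyr R a) :
    ∃! v, v ∈ sub R {a}ᶜ ∧ u = v * letter R a := by
  obtain ⟨v, hv, -, rfl⟩ := exists_eq_mul_letter_of_mem_pyr hrefl hsymm hu
  exact ⟨v, ⟨mem_sub_compl_iff.2 hv, rfl⟩, fun v' hv' =>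
    (mul_right_cancel_trace hrefl hsymm hv'.2).symm⟩

/-- A maximal letter of a pyramidal trace is its apex. -/
theorem eq_of_mul_letter_eq_mul_letter (hrefl : ∀ a, R a a) (hsymm : ∀ a b, R a b → R b a)
    {a c : α} {v y : TraceMonoid R} (hmax : MaxIn R (link R a) v)
    (h : v * letter R a = y * letter R c) : c = a := by
  rcases dvd_mul_letter hrefl hsymm h with ⟨y', hy'⟩ | ⟨h1, x', rfl⟩
  · have : c ∈ supp (letter R a) := by rw [hy', supp_mul, supp_letter]; simp
    rwa [supp_letter] at this
  · exact absurd (hsymm _ _ (maxIn_iff.1 hmax c x' rfl)) (h1 a (by simp [supp_letter]))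

theorem exists_eq_mul_letter {x : TraceMonoid R} (hx : x ≠ 1) : ∃ y c, x = y * letter R c := by
  obtain ⟨w, rfl⟩ := ofWord_surjective x
  induction w using List.reverseRecOn with
  | nil => exact absurd rfl hx
  | append_singleton t c _ => exact ⟨ofWord R t, c, ofWord_concat t c⟩

/-- A maximal letter of the product divides `y`, or else it divides the pyramid and is then its apex
`a`, which belongs to `T`. -/
theorem maxIn_pyramid_mul_iff (hrefl : ∀ a, R a a) (hsymm : ∀ a b, R a b → R b a)
    {T : Set α} {a : α} (ha : a ∈ T) {v : TraceMonoid R} (hmax : MaxIn R (link R a) v)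
    {y : TraceMonoid R} : MaxIn R T (v * letter R a * y) ↔ MaxIn R T y := by
  simp only [maxIn_iff (U := T)]
  constructor
  · rintro h c z rfl
    exact h c (v * letter R a * z) (mul_assoc _ _ _).symm
  · intro h c z hz
    rcases dvd_mul_letter hrefl hsymm hz with ⟨y', hy'⟩ | ⟨-, x', hx'⟩
    · exact h c y' hy'
    · rw [eq_of_mul_letter_eq_mul_letter hrefl hsymm hmax hx']
      exact ha

/-- A trace in which `a` occurs has a pyramidal factor on the left. -/
theorem exists_pyramid_mul {a : α} {x : TraceMonoid R}
    (hx : 0 < occ R a x) :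
    ∃ v y, a ∉ supp v ∧ MaxIn R (link R a) v ∧ x = v * letter R a * y := by
  classical
  -- The factor `v` is chosen of minimal length: a maximal letter of `v` that commutes with `a`
  -- could be moved past `a`, giving a shorter one.
  have hex : ∃ n v y, length R v = n ∧ a ∉ supp v ∧ x = v * letter R a * y := by
    obtain ⟨w, rfl⟩ := ofWord_surjective x
    rw [occ_pos_iff, mem_supp_ofWord] at hx
    obtain ⟨s, u, hs, rfl, -⟩ := List.exists_erase_eq hx
    refine ⟨_, ofWord R s, ofWord R u, rfl, by rwa [mem_supp_ofWord], ?_⟩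
    rw [mul_assoc, ← ofWord_cons, ofWord_append]
  obtain ⟨v, y, hn, hv, rfl⟩ := Nat.find_spec hex
  refine ⟨v, y, hv, maxIn_iff.2 fun c v' hv' => ?_, rfl⟩
  by_contra hc
  refine Nat.find_min hex (m := length R v') ?_ ⟨v', letter R c * y, rfl, ?_, ?_⟩
  · rw [← hn, hv', length_mul, length_letter]; omega
  · rw [hv', supp_mul] at hv
    exact fun h => hv (Or.inl h)
  · rw [hv', mul_assoc v' (letter R c), ← letter_comm (R := R) (a := a) (b := c) hc]
    simp only [mul_assoc]

/-- By Levi's lemma the two pyramids are `p * q` and `p * r` with `q` and `r` commuting letter by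
letter. A nontrivial right divisor of a pyramid contains the apex. Both `q` and `r` cannot contain
`a`, as `R a a`, and one alone cannot either, as each pyramid has exactly one `a`. -/
theorem pyramid_mul_inj (hrefl : ∀ a, R a a) (hsymm : ∀ a b, R a b → R b a) {a : α}
    {v v' y y' : TraceMonoid R} (hv : a ∉ supp v) (hv' : a ∉ supp v')
    (hmax : MaxIn R (link R a) v) (hmax' : MaxIn R (link R a) v')
    (h : v * letter R a * y = v' * letter R a * y') : v = v' ∧ y = y' := by
  obtain ⟨p, q, r, s, h1, h2, h3, h4, h5⟩ := levi hrefl hsymm h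
  have hpyr : ∀ {v p q : TraceMonoid R}, MaxIn R (link R a) v →
      v * letter R a = p * q → q = 1 ∨ a ∈ supp q := by
    intro v p q hmax h
    by_contra! hq
    obtain ⟨z, c, rfl⟩ := exists_eq_mul_letter hq.1
    rw [← mul_assoc] at h
    have := eq_of_mul_letter_eq_mul_letter hrefl hsymm hmax h
    subst this
    exact hq.2 (by rw [supp_mul, supp_letter]; simp)
  have hcount : ∀ {v : TraceMonoid R}, a ∉ supp v → occ R a (v * letter R a) = 1 := by
    intro v hv
    rw [occ_mul, occ_letter_self, occ_eq_zero_iff.2 hv]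
  have hc1 := hcount hv
  have hc2 := hcount hv'
  rw [h1, occ_mul] at hc1
  rw [h3, occ_mul] at hc2
  have hq : q = 1 ∧ r = 1 := by
    rcases hpyr hmax h1 with hq | hq <;> rcases hpyr hmax' h3 with hr | hr
    · exact ⟨hq, hr⟩
    · rw [← occ_pos_iff] at hr
      rw [hq, occ_one] at hc1
      omega
    · rw [← occ_pos_iff] at hq
      rw [hr, occ_one] at hc2
      omega
    · exact absurd (hrefl a) (h5 a hq a hr)
  obtain ⟨rfl, rfl⟩ := hq
  refine ⟨mul_right_cancel_trace hrefl hsymm (h1.trans h3.symm), ?_⟩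
  rw [h2, h4]

/-- The product of `k` pyramidal traces, with apices `a`, and of a remainder. -/
def pyrProd (a : α) {k : ℕ} (v : Fin k → TraceMonoid R) (u : TraceMonoid R) : TraceMonoid R :=
  (List.ofFn fun i => v i * letter R a).prod * u

theorem pyrProd_zero (a : α) (v : Fin 0 → TraceMonoid R) (u : TraceMonoid R) :
    pyrProd a v u = u := by simp [pyrProd]

theorem pyrProd_succ (a : α) {k : ℕ} (v : Fin (k + 1) → TraceMonoid R) (u : TraceMonoid R) :
    pyrProd a v u = v 0 * letter R a * pyrProd a (fun i => v i.succ) u := by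
  simp [pyrProd, List.ofFn_succ, mul_assoc]

/-- The bases of the pyramids and the remainder that occur in decompositions. -/
def IsPyrBase (a : α) {k : ℕ} (v : Fin k → TraceMonoid R) (u : TraceMonoid R) : Prop :=
  (∀ i, a ∉ supp (v i) ∧ MaxIn R (link R a) (v i)) ∧ a ∉ supp u

theorem occ_pyrProd {a : α} {k : ℕ} {v : Fin k → TraceMonoid R} {u : TraceMonoid R}
    (h : IsPyrBase a v u) : occ R a (pyrProd a v u) = k := by
  induction k with
  | zero => rw [pyrProd_zero, occ_eq_zero_iff]; exact h.2
  | succ k ih =>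
    rw [pyrProd_succ, occ_mul, occ_mul, occ_letter_self, occ_eq_zero_iff.2 (h.1 0).1,
      ih ⟨fun i => h.1 i.succ, h.2⟩]
    omega

theorem length_pyrProd (a : α) {k : ℕ} (v : Fin k → TraceMonoid R) (u : TraceMonoid R) :
    length R (pyrProd a v u) = k + ∑ i, length R (v i) + length R u := by
  induction k with
  | zero => simp [pyrProd_zero]
  | succ k ih =>
    rw [pyrProd_succ, length_mul, length_mul, length_letter, ih, Fin.sum_univ_succ]
    omega

theorem maxIn_pyrProd_iff (hrefl : ∀ a, R a a) (hsymm : ∀ a b, R a b → R b a)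
    {T : Set α} {a : α} (ha : a ∈ T) {k : ℕ} {v : Fin k → TraceMonoid R} {u : TraceMonoid R}
    (h : IsPyrBase a v u) : MaxIn R T (pyrProd a v u) ↔ MaxIn R T u := by
  induction k with
  | zero => rw [pyrProd_zero]
  | succ k ih =>
    rw [pyrProd_succ, maxIn_pyramid_mul_iff hrefl hsymm ha (h.1 0).2,
      ih ⟨fun i => h.1 i.succ, h.2⟩]

theorem exists_pyrProd_eq {a : α} {k : ℕ} {x : TraceMonoid R}
    (hx : occ R a x = k) :
    ∃ (v : Fin k → TraceMonoid R) (u : TraceMonoid R), IsPyrBase a v u ∧ pyrProd a v u = x := by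
  induction k generalizing x with
  | zero =>
    exact ⟨Fin.elim0, x, ⟨fun i => i.elim0, occ_eq_zero_iff.1 hx⟩, pyrProd_zero _ _ _⟩
  | succ k ih =>
    obtain ⟨v₀, y, hv₀, hmax, rfl⟩ := exists_pyramid_mul (a := a) (x := x) (by omega)
    rw [occ_mul, occ_mul, occ_letter_self, occ_eq_zero_iff.2 hv₀] at hx
    obtain ⟨v, u, hvu, rfl⟩ := ih (x := y) (by omega)
    refine ⟨Fin.cons v₀ v, u, ⟨Fin.cases ⟨hv₀, hmax⟩ hvu.1, hvu.2⟩, ?_⟩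
    simp [pyrProd_succ]

theorem pyrProd_inj (hrefl : ∀ a, R a a) (hsymm : ∀ a b, R a b → R b a) {a : α} {k : ℕ}
    {v v' : Fin k → TraceMonoid R} {u u' : TraceMonoid R} (h : IsPyrBase a v u)
    (h' : IsPyrBase a v' u') (heq : pyrProd a v u = pyrProd a v' u') : v = v' ∧ u = u' := by
  induction k with
  | zero => exact ⟨Subsingleton.elim _ _, by simpa [pyrProd_zero] using heq⟩
  | succ k ih =>
    rw [pyrProd_succ, pyrProd_succ] at heq
    obtain ⟨h0, h1⟩ := pyramid_mul_inj hrefl hsymm (h.1 0).1 (h'.1 0).1 (h.1 0).2 (h'.1 0).2 heq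
    obtain ⟨h2, h3⟩ := ih ⟨fun i => h.1 i.succ, h.2⟩ ⟨fun i => h'.1 i.succ, h'.2⟩ h1
    refine ⟨funext (Fin.cases h0 fun i => congrFun h2 i), h3⟩

theorem isPyrDecomp_iff (hrefl : ∀ a, R a a) (hsymm : ∀ a b, R a b → R b a) {a : α}
    {x : TraceMonoid R} {k : ℕ} {u : Fin (k + 1) → TraceMonoid R} :
    IsPyrDecomp R a x k u ↔ ∃ v : Fin k → TraceMonoid R, IsPyrBase a v (u (Fin.last k)) ∧
      (∀ i : Fin k, u i.castSucc = v i * letter R a) ∧ pyrProd a v (u (Fin.last k)) = x := by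
  have hprod : ∀ v : Fin k → TraceMonoid R, (∀ i : Fin k, u i.castSucc = v i * letter R a) →
      (List.ofFn u).prod = pyrProd a v (u (Fin.last k)) := by
    intro v hv
    rw [List.ofFn_succ', List.concat_eq_append, List.prod_append, List.prod_singleton, pyrProd]
    simp only [hv]
  constructor
  · rintro ⟨h1, h2, h3⟩
    choose v hv using fun i => (mem_pyr_iff hrefl hsymm).1 (h1 i)
    refine ⟨v, ⟨fun i => ⟨(hv i).1, (hv i).2.1⟩, mem_sub_compl_iff.1 h2⟩, fun i => (hv i).2.2, ?_⟩
    rw [← h3, hprod v fun i => (hv i).2.2]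
  · rintro ⟨v, h1, h2, h3⟩
    refine ⟨fun i => (mem_pyr_iff hrefl hsymm).2 ⟨v i, (h1.1 i).1, (h1.1 i).2, h2 i⟩,
      mem_sub_compl_iff.2 h1.2, ?_⟩
    rw [← h3, hprod v h2]

theorem existsUnique_isPyrDecomp (hrefl : ∀ a, R a a) (hsymm : ∀ a b, R a b → R b a) (a : α)
    (x : TraceMonoid R) : ∃! u, IsPyrDecomp R a x (occ R a x) u := by
  obtain ⟨v, u, h, hx⟩ := exists_pyrProd_eq (a := a) (x := x) rfl
  refine ⟨Fin.snoc (α := fun _ => TraceMonoid R) (fun i => v i * letter R a) u, ?_, ?_⟩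
  · exact (isPyrDecomp_iff hrefl hsymm).2 ⟨v, by simpa using h, by simp, by simpa using hx⟩
  · intro u' hu'
    obtain ⟨v', h', hv', hx'⟩ := (isPyrDecomp_iff hrefl hsymm).1 hu'
    obtain ⟨rfl, hu⟩ := pyrProd_inj hrefl hsymm h' h (hx'.trans hx.symm)
    refine funext (Fin.lastCases ?_ fun i => ?_)
    · simpa using hu
    · simpa using hv' i

end Heaps

/-! ### Möbius inversion for the generating series of traces. -/

section Mobius

variable {α : Type*} {R : α → α → Prop}

/-- A clique divides a trace on the left if and only if each of its letters does. -/
theorem exists_eq_ofWord_mul_iff (hrefl : ∀ a, R a a) (hsymm : ∀ a b, R a b → R b a)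
    {l : List α} (hl : l.Pairwise fun a b => ¬ R a b) {x : TraceMonoid R} :
    (∃ y, x = ofWord R l * y) ↔ ∀ c ∈ l, ∃ y, x = letter R c * y := by
  constructor
  · rintro ⟨y, rfl⟩ c hc
    obtain ⟨s, u, rfl⟩ := List.append_of_mem hc
    refine ⟨ofWord R (s ++ u) * y, ?_⟩
    rw [ofWord_append_cons_of_comm, ofWord_cons, mul_assoc]
    intro b hb hR
    exact (List.pairwise_append.1 hl).2.2 b hb c (by simp) (hsymm _ _ hR)
  · intro h
    induction l generalizing x with
    | nil => exact ⟨x, by simp [ofWord_nil]⟩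
    | cons c t ih =>
      rw [List.pairwise_cons] at hl
      obtain ⟨x, rfl⟩ := h c (by simp)
      obtain ⟨y, rfl⟩ := ih hl.2 (x := x) (by
        intro d hd
        obtain ⟨z, hz⟩ := h d (by simp [hd])
        rcases letter_dvd_mul hrefl hsymm hz with ⟨x', hx'⟩ | ⟨-, h2⟩
        · have : d ∈ supp (letter R c) := by rw [hx', supp_mul, supp_letter]; simp
          rw [supp_letter, Set.mem_singleton_iff] at this
          exact absurd (this ▸ hrefl d) (hl.1 d hd)
        · exact h2)
      exact ⟨y, by rw [ofWord_cons, mul_assoc]⟩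

/-- Hence the minimal letters of a trace form a clique, and so do all their subsets. -/
theorem not_rel_of_letter_dvd (hrefl : ∀ a, R a a) (hsymm : ∀ a b, R a b → R b a) {c d : α}
    (hcd : c ≠ d) {y z : TraceMonoid R} (h : letter R c * y = letter R d * z) : ¬ R c d := by
  rcases letter_dvd_mul hrefl hsymm h with ⟨x', hx'⟩ | ⟨h1, -⟩
  · have : d ∈ supp (letter R c) := by rw [hx', supp_mul, supp_letter]; simp
    rw [supp_letter] at this
    exact absurd this.symm hcd
  · exact fun hR => h1 c (by simp [supp_letter]) (hsymm _ _ hR)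

variable [Fintype α]

open Classical in
/-- The traces of length `n` on the letters of `S`. -/
noncomputable def tracesOfLength (R : α → α → Prop) (S : Set α) (n : ℕ) :
    Finset (TraceMonoid R) :=
  ((Finset.univ : Finset (Fin n → α)).image fun w => ofWord R (List.ofFn w)).filter (· ∈ sub R S)

theorem mem_tracesOfLength {S : Set α} {n : ℕ} {x : TraceMonoid R} :
    x ∈ tracesOfLength R S n ↔ x ∈ sub R S ∧ length R x = n := by
  classical
  simp only [tracesOfLength, Finset.mem_filter, Finset.mem_image, Finset.mem_univ, true_and]
  constructor
  · rintro ⟨⟨w, rfl⟩, h⟩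
    exact ⟨h, by simp [length_ofWord]⟩
  · rintro ⟨h, rfl⟩
    obtain ⟨w, rfl⟩ := ofWord_surjective x
    rw [length_ofWord]
    exact ⟨⟨w.get, by simp⟩, h⟩

theorem card_tracesOfLength_le (S : Set α) (n : ℕ) :
    (tracesOfLength R S n).card ≤ Fintype.card α ^ n := by
  classical
  refine (Finset.card_filter_le _ _).trans (Finset.card_image_le.trans ?_)
  simp

theorem tracesOfLength_mono {S S' : Set α} (h : S ⊆ S') (n : ℕ) :
    tracesOfLength R S n ⊆ tracesOfLength R S' n := by
  intro x
  simp only [mem_tracesOfLength, mem_sub_iff]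
  exact fun hx => ⟨hx.1.trans h, hx.2⟩

/-- The generating series of the traces on the letters of `S`, by length. -/
noncomputable def genSeries (R : α → α → Prop) (S : Set α) : PowerSeries ℤ :=
  PowerSeries.mk fun n => ((tracesOfLength R S n).card : ℤ)

open Classical in
/-- The minimal letters of a trace: its left divisors. -/
noncomputable def minLetters (x : TraceMonoid R) : Finset α :=
  Finset.univ.filter fun c => ∃ y, x = letter R c * y

theorem mem_minLetters {x : TraceMonoid R} {c : α} :
    c ∈ minLetters x ↔ ∃ y, x = letter R c * y := by simp [minLetters]

theorem minLetters_eq_empty_iff {x : TraceMonoid R} : minLetters x = ∅ ↔ x = 1 := by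
  constructor
  · intro h
    obtain ⟨w, rfl⟩ := ofWord_surjective x
    cases w with
    | nil => rfl
    | cons c t =>
      have : c ∈ minLetters (ofWord R (c :: t)) := mem_minLetters.2 ⟨ofWord R t, ofWord_cons c t⟩
      simp [h] at this
  · rintro rfl
    refine Finset.eq_empty_of_forall_notMem fun c hc => ?_
    obtain ⟨y, hy⟩ := mem_minLetters.1 hc
    have := congrArg (length R) hy
    rw [length_mul, length_letter, length_one] at this
    omega

open Classical in
/-- The cliques on the letters of `S`. -/
noncomputable def cliques (R : α → α → Prop) (S : Set α) : Finset (Finset α) :=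
  Finset.univ.filter fun γ : Finset α =>
    (∀ a ∈ γ, a ∈ S) ∧ ∀ a ∈ γ, ∀ b ∈ γ, a ≠ b → ¬ R a b

theorem mem_cliques {S : Set α} {γ : Finset α} : γ ∈ cliques R S ↔
    (∀ a ∈ γ, a ∈ S) ∧ ∀ a ∈ γ, ∀ b ∈ γ, a ≠ b → ¬ R a b := by simp [cliques]

theorem filter_cliques_subset_minLetters (hrefl : ∀ a, R a a) (hsymm : ∀ a b, R a b → R b a)
    {S : Set α} {x : TraceMonoid R} (hx : x ∈ sub R S) [DecidableEq α] :
    (cliques R S).filter (· ⊆ minLetters x) = (minLetters x).powerset := by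
  ext γ
  rw [Finset.mem_filter, Finset.mem_powerset, and_iff_right_iff_imp, mem_cliques]
  intro h
  refine ⟨fun c hc => ?_, fun c hc d hd hcd => ?_⟩
  · obtain ⟨y, rfl⟩ := mem_minLetters.1 (h hc)
    rw [mem_sub_iff, supp_mul, supp_letter] at hx
    exact hx (by simp)
  · obtain ⟨y, hy⟩ := mem_minLetters.1 (h hc)
    obtain ⟨z, hz⟩ := mem_minLetters.1 (h hd)
    exact not_rel_of_letter_dvd hrefl hsymm hcd (hy.symm.trans hz)

-- The traces that all letters of the clique `γ` divide are the multiples of its product, and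
-- multiplication by this product is injective and adds `γ.card` to the length.
open Classical in
theorem card_filter_subset_minLetters (hrefl : ∀ a, R a a) (hsymm : ∀ a b, R a b → R b a)
    {S : Set α} {γ : Finset α} (hγ : γ ∈ cliques R S) (n : ℕ) :
    ((tracesOfLength R S n).filter (γ ⊆ minLetters ·)).card =
      if γ.card ≤ n then (tracesOfLength R S (n - γ.card)).card else 0 := by
  rw [mem_cliques] at hγ
  have hpair : γ.toList.Pairwise fun a b => ¬ R a b :=
    γ.nodup_toList.imp_of_mem fun ha hb hab =>
      hγ.2 _ (Finset.mem_toList.1 ha) _ (Finset.mem_toList.1 hb) hab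
  have hdvd : ∀ x : TraceMonoid R, γ ⊆ minLetters x ↔ ∃ y, x = ofWord R γ.toList * y := by
    intro x
    rw [exists_eq_ofWord_mul_iff hrefl hsymm hpair]
    simp only [Finset.mem_toList, ← mem_minLetters]
    rfl
  have hlen : ∀ y : TraceMonoid R, length R (ofWord R γ.toList * y) = γ.card + length R y := by
    intro y
    rw [length_mul, length_ofWord, Finset.length_toList]
  split_ifs with hn
  · rw [← Finset.card_image_of_injective (tracesOfLength R S (n - γ.card))
      (f := fun y => ofWord R γ.toList * y) fun y z h => mul_left_cancel_trace hrefl hsymm h]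
    congr 1
    ext x
    simp only [Finset.mem_filter, Finset.mem_image, mem_tracesOfLength, hdvd]
    constructor
    · rintro ⟨⟨h1, h2⟩, y, rfl⟩
      rw [hlen] at h2
      rw [mem_sub_iff, supp_mul, Set.union_subset_iff] at h1
      exact ⟨y, ⟨mem_sub_iff.2 h1.2, by omega⟩, rfl⟩
    · rintro ⟨y, ⟨h1, h2⟩, rfl⟩
      refine ⟨⟨?_, by rw [hlen]; omega⟩, y, rfl⟩
      rw [mem_sub_iff] at h1 ⊢
      rw [supp_mul]
      refine Set.union_subset (fun c hc => ?_) h1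
      exact hγ.1 c (Finset.mem_toList.1 (mem_supp_ofWord.1 hc))
  · rw [Finset.card_eq_zero, Finset.filter_eq_empty_iff]
    intro x hx hx'
    obtain ⟨y, rfl⟩ := (hdvd x).1 hx'
    rw [mem_tracesOfLength, hlen] at hx
    omega

/-- The Möbius polynomial is the inverse of the generating series. -/
theorem mobius_mul_genSeries (hrefl : ∀ a, R a a) (hsymm : ∀ a b, R a b → R b a) (S : Set α) :
    (mobius R S : PowerSeries ℤ) * genSeries R S = 1 := by
  classical
  have hmob : (mobius R S : PowerSeries ℤ) =
      ∑ γ ∈ cliques R S, PowerSeries.C ((-1) ^ γ.card) * PowerSeries.X ^ γ.card := by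
    have : mobius R S = ∑ γ ∈ cliques R S, (-1) ^ γ.card * Polynomial.X ^ γ.card := by
      unfold mobius cliques
      rfl
    rw [this, ← Polynomial.coeToPowerSeries.ringHom_apply, map_sum]
    refine Finset.sum_congr rfl fun γ _ => ?_
    simp
  ext n
  have hterm : ∀ γ ∈ cliques R S, PowerSeries.coeff n
      (PowerSeries.C ((-1 : ℤ) ^ γ.card) * PowerSeries.X ^ γ.card * genSeries R S) =
      ∑ x ∈ tracesOfLength R S n, if γ ⊆ minLetters x then (-1) ^ γ.card else 0 := by
    intro γ hγ
    rw [mul_assoc, PowerSeries.coeff_C_mul, PowerSeries.coeff_X_pow_mul', ← Finset.sum_filter,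
      Finset.sum_const, card_filter_subset_minLetters hrefl hsymm hγ]
    split_ifs <;> simp [genSeries, mul_comm]
  -- After exchanging the sums, each trace contributes the alternating sum over the subsets of its
  -- minimal letters. It vanishes unless there are none, that is, unless the trace is `1`.
  rw [hmob, Finset.sum_mul, map_sum, Finset.sum_congr rfl hterm, Finset.sum_comm]
  have hinner : ∀ x ∈ tracesOfLength R S n,
      (∑ γ ∈ cliques R S, if γ ⊆ minLetters x then (-1 : ℤ) ^ γ.card else 0) =
        if x = 1 then 1 else 0 := by
    intro x hx
    rw [← Finset.sum_filter,
      filter_cliques_subset_minLetters hrefl hsymm (mem_tracesOfLength.1 hx).1,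
      Finset.sum_powerset_neg_one_pow_card]
    simp only [minLetters_eq_empty_iff]
  rw [Finset.sum_congr rfl hinner, Finset.sum_ite_eq', PowerSeries.coeff_one]
  congr 1
  rw [mem_tracesOfLength, length_one]
  simp [one_mem, eq_comm]

end Mobius

/-! ### Convergence of the generating series below the smallest root. -/

section Analytic

-- The formal identity becomes numerical through the Cauchy product of absolutely convergent series.
open Polynomial in
theorem aeval_mul_tsum_eq_one {𝕜 : Type*} [RCLike 𝕜] {P : ℤ[X]} {φ : PowerSeries ℤ}
    (h : (P : PowerSeries ℤ) * φ = 1) {z : 𝕜}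
    (hs : Summable fun n => ‖((PowerSeries.coeff n φ : ℤ) : 𝕜) * z ^ n‖) :
    aeval z P * ∑' n, ((PowerSeries.coeff n φ : ℤ) : 𝕜) * z ^ n = 1 := by
  have hP : ∀ n ∉ Finset.range (P.natDegree + 1), (P.coeff n : 𝕜) * z ^ n = 0 := by
    intro n hn
    rw [Finset.mem_range, not_lt] at hn
    rw [P.coeff_eq_zero_of_natDegree_lt (by omega)]
    simp
  have hP' : aeval z P = ∑' n, (P.coeff n : 𝕜) * z ^ n := by
    rw [tsum_eq_sum hP, aeval_eq_sum_range]
    simp [zsmul_eq_mul]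
  have hPs : Summable fun n => ‖(P.coeff n : 𝕜) * z ^ n‖ :=
    summable_of_ne_finset_zero (s := Finset.range (P.natDegree + 1)) fun n hn => by
      rw [hP n hn, norm_zero]
  rw [hP', tsum_mul_tsum_eq_tsum_sum_antidiagonal_of_summable_norm hPs hs]
  have hcoeff : ∀ n : ℕ, ∑ kl ∈ Finset.HasAntidiagonal.antidiagonal n,
      (P.coeff kl.1 : 𝕜) * z ^ kl.1 * (((PowerSeries.coeff kl.2 φ : ℤ) : 𝕜) * z ^ kl.2) =
        if n = 0 then 1 else 0 := by
    intro n
    have h1 := congrArg (fun m : ℤ => (m : 𝕜) * z ^ n) (congrArg (PowerSeries.coeff n) h)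
    simp only [PowerSeries.coeff_mul, PowerSeries.coeff_one, Int.cast_sum, Finset.sum_mul] at h1
    refine Eq.trans (Finset.sum_congr rfl fun kl hkl => ?_) (h1.trans ?_)
    · rw [← Finset.HasAntidiagonal.mem_antidiagonal.1 hkl, pow_add, coeff_coe]
      push_cast
      ring
    · split_ifs with hn <;> simp [hn]
  simp only [hcoeff, tsum_ite_eq]

variable {α : Type*} {R : α → α → Prop} [Fintype α]

theorem coeff_genSeries (S : Set α) (n : ℕ) :
    PowerSeries.coeff n (genSeries R S) = (tracesOfLength R S n).card := by simp [genSeries]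

theorem aeval_mobius_ne_zero_of_enorm_lt {S : Set α} {z : ℂ} (hz : ‖z‖ₑ < smallestRoot R S) :
    Polynomial.aeval z (mobius R S) ≠ 0 :=
  fun h => hz.not_ge (iInf₂_le z h)

/-- The function `1 / μ_S` is holomorphic on a closed disc of radius `q` with `p < q < p_S`, so its
Taylor series converges absolutely at `p`. By uniqueness this is the generating series, since the
two functions agree near `0`. -/
theorem summable_of_lt_smallestRoot (hrefl : ∀ a, R a a) (hsymm : ∀ a b, R a b → R b a)
    {S : Set α} {p : ℝ} (hp0 : 0 ≤ p) (hp : ENNReal.ofReal p < smallestRoot R S) :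
    Summable fun n => ((tracesOfLength R S n).card : ℝ) * p ^ n := by
  obtain ⟨q, hpq, hq⟩ := ENNReal.lt_iff_exists_nnreal_btwn.1 hp
  have hpq' : p < q := by
    rwa [ENNReal.ofReal, ENNReal.coe_lt_coe, ← NNReal.coe_lt_coe, Real.coe_toNNReal _ hp0] at hpq
  have hq0 : 0 < q := by exact_mod_cast hp0.trans_lt hpq'
  let f : ℂ → ℂ := fun z => (Polynomial.aeval z (mobius R S))⁻¹
  have hf : DifferentiableOn ℂ f (Metric.closedBall 0 q) := by
    refine DifferentiableOn.inv (Polynomial.differentiable_aeval _).differentiableOn fun z hz => ?_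
    refine aeval_mobius_ne_zero_of_enorm_lt (lt_of_le_of_lt ?_ hq)
    rw [mem_closedBall_zero_iff] at hz
    rw [← ofReal_norm]
    exact ENNReal.ofReal_le_of_le_toReal (by simpa using hz)
  have hf' := hf.hasFPowerSeriesOnBall hq0
  let φ : FormalMultilinearSeries ℂ ℂ ℂ :=
    FormalMultilinearSeries.ofScalars ℂ fun n => ((tracesOfLength R S n).card : ℂ)
  have hφ : HasFPowerSeriesAt f φ 0 := by
    rw [hasFPowerSeriesAt_iff]
    -- There are at most `|α|^n` traces of length `n`, so the series converges on this ball; the `+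
    -- 1` keeps the radius positive when `α` is empty.
    have hr : (0 : ℝ) < (Fintype.card α + 1 : ℝ)⁻¹ := by positivity
    filter_upwards [Metric.ball_mem_nhds (0 : ℂ) hr] with z hz
    rw [mem_ball_zero_iff] at hz
    have hlt : Fintype.card α * ‖z‖ < 1 := by
      have hN : (0 : ℝ) < Fintype.card α + 1 := by positivity
      have h1 := mul_lt_mul_of_pos_left hz hN
      rw [mul_inv_cancel₀ hN.ne'] at h1
      linarith [norm_nonneg z]
    have hs : Summable fun n =>
        ‖((PowerSeries.coeff n (genSeries R S) : ℤ) : ℂ) * z ^ n‖ := by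
      refine Summable.of_nonneg_of_le (fun n => norm_nonneg _) (fun n => ?_)
        (summable_geometric_of_lt_one (by positivity) hlt)
      rw [norm_mul, norm_pow, mul_pow, coeff_genSeries]
      refine mul_le_mul_of_nonneg_right ?_ (by positivity)
      have := card_tracesOfLength_le (R := R) S n
      simp only [Int.cast_natCast, Complex.norm_natCast]
      exact_mod_cast this
    have h1 := aeval_mul_tsum_eq_one (mobius_mul_genSeries hrefl hsymm S) hs
    have h2 := hs.of_norm.hasSum
    rw [eq_inv_of_mul_eq_one_right h1] at h2
    simpa [φ, f, FormalMultilinearSeries.coeff_ofScalars, coeff_genSeries, mul_comm] using h2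
  rw [← hφ.eq_formalMultilinearSeries hf'.hasFPowerSeriesAt] at hf'
  have hsum := φ.summable_norm_mul_pow (lt_of_lt_of_le hpq hf'.r_le)
  simpa [φ, Real.coe_toNNReal _ hp0] using hsum

/-- At a root of `μ_S` of modulus less than `p_Σ`, the series for `S`, dominated by the one for `Σ`,
would converge, and its product with `0` would be `1`. -/
theorem smallestRoot_univ_le (hrefl : ∀ a, R a a) (hsymm : ∀ a b, R a b → R b a)
    (S : Set α) : smallestRoot R Set.univ ≤ smallestRoot R S := by
  refine le_iInf₂ fun z hz => ?_
  by_contra! hlt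
  rw [← ofReal_norm] at hlt
  have h1 := summable_of_lt_smallestRoot hrefl hsymm (norm_nonneg z) hlt
  have hs : Summable fun n =>
      ‖((PowerSeries.coeff n (genSeries R S) : ℤ) : ℂ) * z ^ n‖ := by
    refine Summable.of_nonneg_of_le (fun n => norm_nonneg _) (fun n => ?_) h1
    rw [norm_mul, norm_pow, coeff_genSeries]
    refine mul_le_mul_of_nonneg_right ?_ (by positivity)
    have := Finset.card_le_card (tracesOfLength_mono (R := R) (Set.subset_univ S) n)
    simp only [Int.cast_natCast, Complex.norm_natCast]
    exact_mod_cast this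
  have h2 := aeval_mul_tsum_eq_one (mobius_mul_genSeries hrefl hsymm S) hs
  rw [hz, zero_mul] at h2
  exact zero_ne_one h2

theorem mobiusAt_mul_tsum (hrefl : ∀ a, R a a) (hsymm : ∀ a b, R a b → R b a)
    {S : Set α} {p : ℝ} (hp0 : 0 ≤ p) (hp : ENNReal.ofReal p < smallestRoot R S) :
    mobiusAt R S p * ∑' n, ((tracesOfLength R S n).card : ℝ) * p ^ n = 1 := by
  have hs := summable_of_lt_smallestRoot hrefl hsymm hp0 hp
  have h := aeval_mul_tsum_eq_one (mobius_mul_genSeries hrefl hsymm S) (z := p) (by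
    simpa [coeff_genSeries, abs_of_nonneg hp0] using hs)
  simpa [coeff_genSeries, mobiusAt] using h

theorem mobiusAt_pos (hrefl : ∀ a, R a a) (hsymm : ∀ a b, R a b → R b a)
    {S : Set α} {p : ℝ} (hp0 : 0 ≤ p) (hp : ENNReal.ofReal p < smallestRoot R S) :
    0 < mobiusAt R S p := by
  have h := mobiusAt_mul_tsum hrefl hsymm hp0 hp
  have h0 : 0 ≤ ∑' n, ((tracesOfLength R S n).card : ℝ) * p ^ n :=
    tsum_nonneg fun n => by positivity
  exact pos_of_mul_pos_left (h ▸ one_pos) h0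

end Analytic

/-! ### Weights of traces and their factorisation along the pyramids. -/

section Measures

variable {α : Type*} {R : α → α → Prop}

instance : DiscreteMeasurableSpace (TraceMonoid R) := ⟨fun _ => trivial⟩

instance [Fintype α] : Countable (TraceMonoid R) := ofWord_surjective.countable

theorem sum_restrict_fiber {Ω : Type*} [MeasurableSpace Ω] (P : Measure Ω) {K : Ω → ℕ}
    (hK : Measurable K) : Measure.sum (fun k => P.restrict {ω | K ω = k}) = P := by
  have hU : (⋃ k, {ω | K ω = k}) = Set.univ := by ext; simp
  have hd : Pairwise (Function.onFun Disjoint fun k => {ω | K ω = k}) := fun i j hij =>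
    Set.disjoint_left.2 fun ω h1 h2 => hij (h1.symm.trans h2)
  have hm : ∀ k, MeasurableSet {ω | K ω = k} := fun k => hK (measurableSet_singleton k)
  rw [← Measure.restrict_iUnion hd hm, hU, Measure.restrict_univ]

theorem measure_eq_zero_of_singleton {β : Type*} [MeasurableSpace β] [Countable β] {m : Measure β}
    {s : Set β} (h : ∀ x ∈ s, m {x} = 0) : m s = 0 := by
  rw [← Set.biUnion_of_singleton s]
  exact (measure_biUnion_null_iff s.to_countable).2 h

/-- The product law of `k` bases and a remainder. -/
noncomputable def pyrPi (mL mT : Measure (TraceMonoid R)) (k : ℕ) :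
    Measure (Fin (k + 1) → TraceMonoid R) :=
  Measure.pi (Fin.snoc (α := fun _ => Measure (TraceMonoid R)) (fun _ : Fin k => mL) mT)

/-- `pyrProd` for the bases and the remainder given as one vector. -/
def pyrMap (a : α) {k : ℕ} (w : Fin (k + 1) → TraceMonoid R) : TraceMonoid R :=
  pyrProd a (fun i : Fin k => w i.castSucc) (w (Fin.last k))

theorem sigmaFinite_snoc {mL mT : Measure (TraceMonoid R)} [SigmaFinite mL] [SigmaFinite mT]
    {k : ℕ} (i : Fin (k + 1)) : SigmaFinite
      (Fin.snoc (α := fun _ => Measure (TraceMonoid R)) (fun _ : Fin k => mL) mT i) := by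
  refine Fin.lastCases ?_ (fun i => ?_) i
  · rw [Fin.snoc_last]; infer_instance
  · rw [Fin.snoc_castSucc]; infer_instance

theorem pyrPi_singleton {mL mT : Measure (TraceMonoid R)} [SigmaFinite mL] [SigmaFinite mT]
    {k : ℕ} (w : Fin (k + 1) → TraceMonoid R) :
    pyrPi mL mT k {w} = (∏ i : Fin k, mL {w i.castSucc}) * mT {w (Fin.last k)} := by
  have := @sigmaFinite_snoc α R mL mT _ _ k
  rw [pyrPi, Measure.pi_singleton, Fin.prod_univ_castSucc]
  simp

theorem pyrPi_univ {mL mT : Measure (TraceMonoid R)} [SigmaFinite mL] [SigmaFinite mT] {k : ℕ} :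
    pyrPi mL mT k Set.univ = mL Set.univ ^ k * mT Set.univ := by
  have := @sigmaFinite_snoc α R mL mT _ _ k
  rw [pyrPi, Measure.pi_univ, Fin.prod_univ_castSucc]
  simp

variable [Fintype α]

theorem ae_isPyrBase {a : α} {mL mT : Measure (TraceMonoid R)} [SigmaFinite mL] [SigmaFinite mT]
    (hL : ∀ v, ¬ (a ∉ supp v ∧ MaxIn R (link R a) v) → mL {v} = 0)
    (hT : ∀ u, a ∈ supp u → mT {u} = 0) (k : ℕ) :
    ∀ᵐ w ∂pyrPi mL mT k, IsPyrBase a (fun i : Fin k => w i.castSucc) (w (Fin.last k)) := by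
  refine measure_eq_zero_of_singleton fun w hw => ?_
  rw [pyrPi_singleton]
  simp only [IsPyrBase, Set.mem_compl_iff, Set.mem_ofPred_eq, not_and_or, not_forall] at hw
  rcases hw with ⟨i, hi⟩ | hw
  · rw [Finset.prod_eq_zero (Finset.mem_univ i) (hL _ (by rwa [not_and_or])), zero_mul]
  · rw [hT _ (not_not.1 hw), mul_zero]

/-- A measure that is multiplicative along the decompositions is, on the traces with `k` letters
`a`, the image of a product measure. -/
theorem restrict_occ_eq_map (hrefl : ∀ a, R a a) (hsymm : ∀ a b, R a b → R b a) {a : α}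
    {m mL mT : Measure (TraceMonoid R)} [SigmaFinite mL] [SigmaFinite mT]
    (hL : ∀ v, ¬ (a ∉ supp v ∧ MaxIn R (link R a) v) → mL {v} = 0)
    (hT : ∀ u, a ∈ supp u → mT {u} = 0) {k : ℕ} {c : ℝ≥0∞}
    (hm : ∀ (v : Fin k → TraceMonoid R) (u : TraceMonoid R), IsPyrBase a v u →
      m {pyrProd a v u} = c * ((∏ i, mL {v i}) * mT {u})) :
    m.restrict {x | occ R a x = k} = c • (pyrPi mL mT k).map (pyrMap a) := by
  refine Measure.ext_of_singleton fun x => ?_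
  have hae := ae_isPyrBase hL hT k
  rw [Measure.restrict_apply (MeasurableSet.of_discrete), Measure.smul_apply, smul_eq_mul,
    Measure.map_apply Measurable.of_discrete MeasurableSet.of_discrete]
  by_cases hx : occ R a x = k
  · obtain ⟨v, u, hvu, rfl⟩ := exists_pyrProd_eq hx
    have h1 : ({pyrProd a v u} : Set (TraceMonoid R)) ∩ {x | occ R a x = k} =
        {pyrProd a v u} := Set.inter_eq_left.2 (by simpa using hx)
    -- Up to a null set, uniqueness of the decomposition reduces the fibre to one vector.
    have h2 : pyrPi mL mT k (pyrMap a ⁻¹' {pyrProd a v u}) =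
        pyrPi mL mT k {Fin.snoc (α := fun _ => TraceMonoid R) v u} := by
      refine measure_congr (Filter.eventuallyEq_set.2 ?_)
      filter_upwards [hae] with w hw
      refine ⟨fun h => ?_, fun h => ?_⟩
      · obtain ⟨hv, hu⟩ := pyrProd_inj hrefl hsymm hw hvu h
        refine funext (Fin.lastCases ?_ fun i => ?_)
        · simpa using hu
        · simpa using congrFun hv i
      · rw [Set.mem_singleton_iff.1 h]
        simp [pyrMap]
    rw [h1, h2, hm v u hvu, pyrPi_singleton]
    simp
  · have h1 : ({x} : Set (TraceMonoid R)) ∩ {x | occ R a x = k} = ∅ := by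
      ext y
      simp only [Set.mem_inter_iff, Set.mem_singleton_iff, Set.mem_ofPred_eq, Set.mem_empty_iff_false,
        iff_false]
      rintro ⟨rfl, h⟩
      exact hx h
    have h2 : pyrPi mL mT k (pyrMap a ⁻¹' {x}) = pyrPi mL mT k ∅ := by
      refine measure_congr (Filter.eventuallyEq_set.2 ?_)
      filter_upwards [hae] with w hw
      refine ⟨fun h => hx ?_, fun h => h.elim⟩
      rw [← show pyrMap a w = x from h]
      exact occ_pyrProd hw
    rw [h1, h2, measure_empty, measure_empty, mul_zero]

open Classical in
/-- The measure that gives mass `p^|x|` to each trace `x` on `S` with `max(x) ⊆ U`. -/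
noncomputable def rawMeasure (R : α → α → Prop) (S U : Set α) (p : ℝ) : Measure (TraceMonoid R) :=
  Measure.sum fun x : TraceMonoid R =>
    (if x ∈ sub R S ∧ MaxIn R U x then ENNReal.ofReal p ^ length R x else 0) • Measure.dirac x

open Classical in
theorem rawMeasure_singleton (S U : Set α) (p : ℝ) (x : TraceMonoid R) :
    rawMeasure R S U p {x} =
      if x ∈ sub R S ∧ MaxIn R U x then ENNReal.ofReal p ^ length R x else 0 := by
  rw [rawMeasure, Measure.sum_smul_dirac_singleton]

theorem measure_univ_eq_tsum_fiber {Ω : Type*} [MeasurableSpace Ω] (P : Measure Ω) {K : Ω → ℕ}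
    (hK : Measurable K) : P Set.univ = ∑' k, P {ω | K ω = k} := by
  conv_lhs => rw [← sum_restrict_fiber P hK]
  rw [Measure.sum_apply _ MeasurableSet.univ]
  simp

theorem rawMeasure_univ_univ (S : Set α) (p : ℝ) :
    rawMeasure R S Set.univ p Set.univ =
      ∑' n, ((tracesOfLength R S n).card : ℝ≥0∞) * ENNReal.ofReal p ^ n := by
  classical
  rw [measure_univ_eq_tsum_fiber _ (Measurable.of_discrete (f := length R))]
  refine tsum_congr fun n => ?_
  have h : rawMeasure R S Set.univ p (tracesOfLength R S n) =
      rawMeasure R S Set.univ p {x | length R x = n} := by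
    refine measure_eq_measure_of_null_sdiff (fun x hx => ?_) ?_
    · exact (mem_tracesOfLength.1 (Finset.mem_coe.1 hx)).2
    · refine measure_eq_zero_of_singleton fun x hx => ?_
      rw [rawMeasure_singleton, if_neg]
      exact fun h => hx.2 (Finset.mem_coe.2 (mem_tracesOfLength.2 ⟨h.1, hx.1⟩))
  rw [← h, ← sum_measure_singleton, Finset.sum_congr rfl (g := fun _ => ENNReal.ofReal p ^ n),
    Finset.sum_const, nsmul_eq_mul]
  intro x hx
  rw [mem_tracesOfLength] at hx
  rw [rawMeasure_singleton, if_pos ⟨hx.1, maxIn_univ x⟩, hx.2]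

theorem restrict_rawMeasure (S T : Set α) (p : ℝ) :
    (rawMeasure R S Set.univ p).restrict {x | MaxIn R T x} = rawMeasure R S T p := by
  classical
  refine Measure.ext_of_singleton fun x => ?_
  rw [Measure.restrict_apply MeasurableSet.of_discrete]
  by_cases hx : MaxIn R T x
  · rw [Set.inter_eq_left.2 (by simpa using hx), rawMeasure_singleton, rawMeasure_singleton]
    simp [hx, maxIn_univ]
  · have : ({x} : Set (TraceMonoid R)) ∩ {x | MaxIn R T x} = ∅ := by
      rw [Set.singleton_inter_eq_empty]; exact hx
    rw [this, measure_empty, rawMeasure_singleton]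
    simp [hx]

theorem multMeasure_eq (S : Set α) {p : ℝ} (hp0 : 0 ≤ p) (hmu : 0 ≤ mobiusAt R S p) :
    multMeasure R S p = ENNReal.ofReal (mobiusAt R S p) • rawMeasure R S Set.univ p := by
  classical
  refine Measure.ext_of_singleton fun x => ?_
  rw [Measure.smul_apply, rawMeasure_singleton, multMeasure,
    Measure.sum_apply _ MeasurableSet.of_discrete]
  simp only [Measure.smul_apply, smul_eq_mul, Measure.dirac_apply, maxIn_univ, and_true]
  by_cases hx : x ∈ sub R S
  · rw [tsum_eq_single ⟨x, hx⟩ fun y hy => ?_]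
    · simp [hx, ENNReal.ofReal_mul hmu, ENNReal.ofReal_pow hp0]
    · have : (y : TraceMonoid R) ≠ x := fun h => hy (Subtype.ext h)
      simp [this]
  · rw [if_neg hx, mul_zero, ENNReal.tsum_eq_zero]
    intro y
    have : (y : TraceMonoid R) ≠ x := fun h => hx (h ▸ y.2)
    simp [this]

theorem rawMeasure_univ_eq_inv (hrefl : ∀ a, R a a) (hsymm : ∀ a b, R a b → R b a)
    {S : Set α} {p : ℝ} (hp0 : 0 ≤ p) (hp : ENNReal.ofReal p < smallestRoot R S) :
    rawMeasure R S Set.univ p Set.univ = (ENNReal.ofReal (mobiusAt R S p))⁻¹ := by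
  have hs := summable_of_lt_smallestRoot hrefl hsymm hp0 hp
  rw [← ENNReal.ofReal_inv_of_pos (mobiusAt_pos hrefl hsymm hp0 hp),
    ← eq_inv_of_mul_eq_one_right (mobiusAt_mul_tsum hrefl hsymm hp0 hp),
    ENNReal.ofReal_tsum_of_nonneg (fun n => by positivity) hs, rawMeasure_univ_univ]
  refine tsum_congr fun n => ?_
  rw [ENNReal.ofReal_mul (by positivity), ENNReal.ofReal_pow hp0, ENNReal.ofReal_natCast]

theorem isProbabilityMeasure_multMeasure (hrefl : ∀ a, R a a) (hsymm : ∀ a b, R a b → R b a)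
    {S : Set α} {p : ℝ} (hp0 : 0 ≤ p) (hp : ENNReal.ofReal p < smallestRoot R S) :
    IsProbabilityMeasure (multMeasure R S p) := by
  have hmu := mobiusAt_pos hrefl hsymm hp0 hp
  refine ⟨?_⟩
  rw [multMeasure_eq S hp0 hmu.le, Measure.smul_apply, smul_eq_mul,
    rawMeasure_univ_eq_inv hrefl hsymm hp0 hp]
  exact ENNReal.mul_inv_cancel (by simpa using hmu) ENNReal.ofReal_ne_top

/-- The empty trace has weight `1` and no maximal piece, so the normalising constants never vanish.
-/
theorem one_le_rawMeasure_univ (S T : Set α) (p : ℝ) :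
    1 ≤ rawMeasure R S T p Set.univ := by
  classical
  refine le_trans ?_ (measure_mono (Set.subset_univ {1}))
  rw [rawMeasure_singleton, if_pos ⟨one_mem _, maxIn_one T⟩, length_one, pow_zero]

theorem rawMeasure_univ_ne_top (hrefl : ∀ a, R a a) (hsymm : ∀ a b, R a b → R b a)
    {S : Set α} (T : Set α) {p : ℝ} (hp0 : 0 ≤ p) (hp : ENNReal.ofReal p < smallestRoot R S) :
    rawMeasure R S T p Set.univ ≠ ∞ := by
  have h : rawMeasure R S Set.univ p Set.univ ≠ ∞ := by
    rw [rawMeasure_univ_eq_inv hrefl hsymm hp0 hp]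
    simpa using mobiusAt_pos hrefl hsymm hp0 hp
  refine ne_top_of_le_ne_top h ?_
  rw [← restrict_rawMeasure]
  exact Measure.restrict_apply_le _ _

/-- The factor `μ_S(p)` cancels in the conditioning, so one may work with the bare weights. -/
theorem condMeasure_eq (hrefl : ∀ a, R a a) (hsymm : ∀ a b, R a b → R b a)
    {S : Set α} (T : Set α) {p : ℝ} (hp0 : 0 ≤ p) (hp : ENNReal.ofReal p < smallestRoot R S) :
    condMeasure R S p T = (rawMeasure R S T p Set.univ)⁻¹ • rawMeasure R S T p := by
  have hmu := mobiusAt_pos hrefl hsymm hp0 hp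
  have hmu' : ENNReal.ofReal (mobiusAt R S p) ≠ 0 := by simpa using hmu
  have hW : rawMeasure R S Set.univ p {x | MaxIn R T x} = rawMeasure R S T p Set.univ := by
    rw [← restrict_rawMeasure S T, Measure.restrict_apply_univ]
  rw [condMeasure, ProbabilityTheory.cond, multMeasure_eq S hp0 hmu.le, Measure.restrict_smul,
    restrict_rawMeasure, Measure.smul_apply, smul_eq_mul, hW, smul_smul,
    ENNReal.mul_inv (Or.inl hmu') (Or.inl ENNReal.ofReal_ne_top), mul_right_comm,
    ENNReal.inv_mul_cancel hmu' ENNReal.ofReal_ne_top, one_mul]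

theorem isProbabilityMeasure_condMeasure (hrefl : ∀ a, R a a) (hsymm : ∀ a b, R a b → R b a)
    {S : Set α} (T : Set α) {p : ℝ} (hp0 : 0 ≤ p) (hp : ENNReal.ofReal p < smallestRoot R S) :
    IsProbabilityMeasure (condMeasure R S p T) := by
  refine ⟨?_⟩
  rw [condMeasure_eq hrefl hsymm T hp0 hp, Measure.smul_apply, smul_eq_mul]
  exact ENNReal.inv_mul_cancel (zero_lt_one.trans_le (one_le_rawMeasure_univ S T p)).ne'
    (rawMeasure_univ_ne_top hrefl hsymm T hp0 hp)

theorem rawMeasure_pyrProd (hrefl : ∀ a, R a a) (hsymm : ∀ a b, R a b → R b a)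
    {T : Set α} {a : α} (ha : a ∈ T) (p : ℝ) {k : ℕ} {v : Fin k → TraceMonoid R}
    {u : TraceMonoid R} (h : IsPyrBase a v u) :
    rawMeasure R Set.univ T p {pyrProd a v u} = ENNReal.ofReal p ^ k *
      ((∏ i, rawMeasure R {a}ᶜ (link R a) p {v i}) * rawMeasure R {a}ᶜ T p {u}) := by
  classical
  have hv : ∀ i, rawMeasure R {a}ᶜ (link R a) p {v i} = ENNReal.ofReal p ^ length R (v i) :=
    fun i => by rw [rawMeasure_singleton, if_pos ⟨mem_sub_compl_iff.2 (h.1 i).1, (h.1 i).2⟩]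
  simp only [hv, rawMeasure_singleton, mem_sub_univ, maxIn_pyrProd_iff hrefl hsymm ha h,
    mem_sub_compl_iff.2 h.2, true_and, length_pyrProd, pow_add, Finset.prod_pow_eq_pow_sum,
    mul_assoc]
  split_ifs <;> simp

theorem rawMeasure_link_eq_zero {a : α} {p : ℝ} (v : TraceMonoid R)
    (hv : ¬ (a ∉ supp v ∧ MaxIn R (link R a) v)) :
    rawMeasure R {a}ᶜ (link R a) p {v} = 0 := by
  classical
  rw [rawMeasure_singleton, if_neg (by rwa [mem_sub_compl_iff])]

theorem rawMeasure_compl_eq_zero {a : α} {T : Set α} {p : ℝ} (u : TraceMonoid R)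
    (hu : a ∈ supp u) : rawMeasure R {a}ᶜ T p {u} = 0 := by
  classical
  rw [rawMeasure_singleton, if_neg]
  exact fun h => mem_sub_compl_iff.1 h.1 hu

/-- The generating function of the pyramidal traces, at `p`. -/
noncomputable def pyrMass (R : α → α → Prop) (a : α) (p : ℝ) : ℝ≥0∞ :=
  ENNReal.ofReal p * rawMeasure R {a}ᶜ (link R a) p Set.univ

theorem rawMeasure_occ_eq (hrefl : ∀ a, R a a) (hsymm : ∀ a b, R a b → R b a)
    {T : Set α} {a : α} (ha : a ∈ T) {p : ℝ} (hp0 : 0 ≤ p)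
    (hp : ENNReal.ofReal p < smallestRoot R {a}ᶜ) (k : ℕ) :
    rawMeasure R Set.univ T p {x | occ R a x = k} =
      pyrMass R a p ^ k * rawMeasure R {a}ᶜ T p Set.univ := by
  have : IsFiniteMeasure (rawMeasure R {a}ᶜ (link R a) p) :=
    ⟨(rawMeasure_univ_ne_top hrefl hsymm _ hp0 hp).lt_top⟩
  have : IsFiniteMeasure (rawMeasure R {a}ᶜ T p) :=
    ⟨(rawMeasure_univ_ne_top hrefl hsymm _ hp0 hp).lt_top⟩
  rw [← Measure.restrict_apply_univ, restrict_occ_eq_map hrefl hsymm rawMeasure_link_eq_zero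
    rawMeasure_compl_eq_zero fun v u h => rawMeasure_pyrProd hrefl hsymm ha p h,
    Measure.smul_apply, Measure.map_apply Measurable.of_discrete MeasurableSet.univ,
    Set.preimage_univ, pyrPi_univ, smul_eq_mul, pyrMass, mul_pow, mul_assoc]

/-- This is a geometric sum over the number of pyramids. In `ℝ≥0∞` it needs no convergence: both
sides are infinite if `pyrMass` is at least `1`. -/
theorem rawMeasure_univ_eq (hrefl : ∀ a, R a a) (hsymm : ∀ a b, R a b → R b a)
    {T : Set α} {a : α} (ha : a ∈ T) {p : ℝ} (hp0 : 0 ≤ p)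
    (hp : ENNReal.ofReal p < smallestRoot R {a}ᶜ) :
    rawMeasure R Set.univ T p Set.univ =
      (1 - pyrMass R a p)⁻¹ * rawMeasure R {a}ᶜ T p Set.univ := by
  rw [measure_univ_eq_tsum_fiber _ (Measurable.of_discrete (f := occ R a))]
  simp only [rawMeasure_occ_eq hrefl hsymm ha hp0 hp]
  rw [ENNReal.tsum_mul_right, ENNReal.tsum_geometric]

/-- The weight of the pyramidal traces in terms of the Möbius polynomials. -/
theorem pyrMass_eq (hrefl : ∀ a, R a a) (hsymm : ∀ a b, R a b → R b a) {a : α} {p : ℝ}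
    (hp0 : 0 ≤ p) (hp : ENNReal.ofReal p < smallestRoot R Set.univ) :
    pyrMass R a p < 1 ∧
      1 - mobiusAt R Set.univ p / mobiusAt R {a}ᶜ p = (pyrMass R a p).toReal := by
  have hp' := hp.trans_le (smallestRoot_univ_le hrefl hsymm {a}ᶜ)
  have hmu := mobiusAt_pos hrefl hsymm hp0 hp
  have hmu' := mobiusAt_pos hrefl hsymm hp0 hp'
  have h := rawMeasure_univ_eq hrefl hsymm (Set.mem_univ a) hp0 hp'
  rw [rawMeasure_univ_eq_inv hrefl hsymm hp0 hp, rawMeasure_univ_eq_inv hrefl hsymm hp0 hp'] at h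
  have hlt : pyrMass R a p < 1 := by
    -- Otherwise the total weight would be infinite, whereas it is `1 / μ_Σ(p)` with `μ_Σ(p) > 0`.
    by_contra! hge
    rw [tsub_eq_zero_of_le hge, ENNReal.inv_zero, ENNReal.top_mul (by simp)] at h
    exact hmu.not_ge (by simpa using h)
  refine ⟨hlt, ?_⟩
  have h2 := congrArg ENNReal.toReal h
  rw [ENNReal.toReal_mul, ENNReal.toReal_inv, ENNReal.toReal_inv, ENNReal.toReal_inv,
    ENNReal.toReal_ofReal hmu.le, ENNReal.toReal_ofReal hmu'.le,
    ENNReal.toReal_sub_of_le hlt.le ENNReal.one_ne_top, ENNReal.toReal_one] at h2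
  rw [← mul_inv, inv_inj] at h2
  rw [h2, mul_div_assoc, div_self hmu'.ne']
  ring

theorem pyrMass_pos {a : α} {p : ℝ} (hp0 : 0 < p) : 0 < pyrMass R a p :=
  ENNReal.mul_pos (by simpa using hp0) (zero_lt_one.trans_le (one_le_rawMeasure_univ _ _ p)).ne'

/-- On the traces with `k` letters `a`, the conditioned multiplicative measure is the image of a
product law. -/
theorem condMeasure_restrict_occ (hrefl : ∀ a, R a a) (hsymm : ∀ a b, R a b → R b a)
    {T : Set α} {a : α} (ha : a ∈ T) {p : ℝ} (hp0 : 0 ≤ p)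
    (hp : ENNReal.ofReal p < smallestRoot R Set.univ) (k : ℕ) :
    (condMeasure R Set.univ p T).restrict {x | occ R a x = k} =
      ((1 - pyrMass R a p) * pyrMass R a p ^ k) •
        (pyrPi (condMeasure R {a}ᶜ p (link R a)) (condMeasure R {a}ᶜ p T) k).map (pyrMap a) := by
  have hp' := hp.trans_le (smallestRoot_univ_le hrefl hsymm {a}ᶜ)
  have := isProbabilityMeasure_condMeasure hrefl hsymm (link R a) hp0 hp'
  have := isProbabilityMeasure_condMeasure hrefl hsymm T hp0 hp'
  have hL := condMeasure_eq hrefl hsymm (link R a) hp0 hp'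
  have hT := condMeasure_eq hrefl hsymm T hp0 hp'
  have hA0 := (zero_lt_one.trans_le (one_le_rawMeasure_univ (R := R) {a}ᶜ (link R a) p)).ne'
  have hAt := rawMeasure_univ_ne_top hrefl hsymm (link R a) hp0 hp'
  have hC0 := (zero_lt_one.trans_le (one_le_rawMeasure_univ (R := R) {a}ᶜ T p)).ne'
  have hCt := rawMeasure_univ_ne_top hrefl hsymm T hp0 hp'
  refine restrict_occ_eq_map hrefl hsymm (fun v hv => ?_) (fun u hu => ?_) fun v u h => ?_
  · rw [hL, Measure.smul_apply, rawMeasure_link_eq_zero v hv, smul_zero]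
  · rw [hT, Measure.smul_apply, rawMeasure_compl_eq_zero u hu, smul_zero]
  · rw [condMeasure_eq hrefl hsymm T hp0 hp, hL, hT]
    simp only [Measure.smul_apply, smul_eq_mul]
    rw [rawMeasure_pyrProd hrefl hsymm ha p h, rawMeasure_univ_eq hrefl hsymm ha hp0 hp',
      Finset.prod_mul_distrib, Finset.prod_const, Finset.card_univ, Fintype.card_fin,
      ENNReal.mul_inv (Or.inr hCt) (Or.inr hC0), inv_inv]
    -- Normalising the `k` bases turns the weight `p^k` of the apices into the `k`-th power of the
    -- pyramid mass.
    have hA : (pyrMass R a p) ^ k * (rawMeasure R {a}ᶜ (link R a) p Set.univ)⁻¹ ^ k =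
        ENNReal.ofReal p ^ k := by
      rw [← mul_pow, pyrMass, mul_assoc, ENNReal.mul_inv_cancel hA0 hAt, mul_one]
    rw [← hA]
    ring

end Measures

/-! ### From identities of measures to laws and independence of random factors. -/

section Laws

variable {α : Type*} {R : α → α → Prop}

theorem isProbabilityMeasure_snoc {mL mT : Measure (TraceMonoid R)} [IsProbabilityMeasure mL]
    [IsProbabilityMeasure mT] {k : ℕ} (i : Fin (k + 1)) : IsProbabilityMeasure
      (Fin.snoc (α := fun _ => Measure (TraceMonoid R)) (fun _ : Fin k => mL) mT i) := by
  refine Fin.lastCases ?_ (fun i => ?_) i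
  · rw [Fin.snoc_last]; infer_instance
  · rw [Fin.snoc_castSucc]; infer_instance

instance {mL mT : Measure (TraceMonoid R)} [IsProbabilityMeasure mL]
    [IsProbabilityMeasure mT] {k : ℕ} : IsProbabilityMeasure (pyrPi mL mT k) := by
  refine ⟨?_⟩
  rw [pyrPi_univ]
  simp

theorem map_eval_pyrPi {mL mT : Measure (TraceMonoid R)} [IsProbabilityMeasure mL]
    [IsProbabilityMeasure mT] {k : ℕ} (i : Fin (k + 1)) :
    (pyrPi mL mT k).map (fun w => w i) =
      Fin.snoc (α := fun _ => Measure (TraceMonoid R)) (fun _ : Fin k => mL) mT i := by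
  have := @isProbabilityMeasure_snoc α R mL mT _ _ k
  exact (measurePreserving_eval _ i).map_eq

theorem aemeasurable_apply {Ω : Type*} [MeasurableSpace Ω] {P : Measure Ω} {k : ℕ}
    {W : Ω → Fin (k + 1) → TraceMonoid R} (hW : AEMeasurable W P) (i : Fin (k + 1)) :
    AEMeasurable (fun ω => W ω i) P :=
  (measurable_pi_apply i).comp_aemeasurable hW

section

variable {Ω : Type*} [MeasurableSpace Ω] {P : Measure Ω} {k : ℕ}
  {W : Ω → Fin (k + 1) → TraceMonoid R} {mL mT : Measure (TraceMonoid R)}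

theorem hasLaw_pyrPi_of_iIndepFun [IsProbabilityMeasure P]
    (hind : iIndepFun (fun i ω => W ω i) P)
    (hlaw : ∀ i, HasLaw (fun ω => W ω i)
      (Fin.snoc (α := fun _ => Measure (TraceMonoid R)) (fun _ : Fin k => mL) mT i) P) :
    HasLaw W (pyrPi mL mT k) P := by
  refine ⟨aemeasurable_pi_iff.2 fun i => (hlaw i).aemeasurable, ?_⟩
  rw [iIndepFun_iff_map_fun_eq_pi_map fun i => (hlaw i).aemeasurable] at hind
  simp only [(hlaw _).map_eq] at hind
  exact hind

variable [IsProbabilityMeasure mL] [IsProbabilityMeasure mT]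

theorem hasLaw_apply_of_pyrPi (hW : HasLaw W (pyrPi mL mT k) P) (i : Fin (k + 1)) :
    HasLaw (fun ω => W ω i)
      (Fin.snoc (α := fun _ => Measure (TraceMonoid R)) (fun _ : Fin k => mL) mT i) P := by
  refine ⟨aemeasurable_apply hW.aemeasurable i, ?_⟩
  rw [← map_eval_pyrPi, ← hW.map_eq, AEMeasurable.map_map_of_aemeasurable
    (measurable_pi_apply i).aemeasurable hW.aemeasurable]
  rfl

theorem iIndepFun_of_pyrPi [IsProbabilityMeasure P] (hW : HasLaw W (pyrPi mL mT k) P) :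
    iIndepFun (fun i ω => W ω i) P := by
  rw [iIndepFun_iff_map_fun_eq_pi_map fun i => aemeasurable_apply hW.aemeasurable i]
  simp only [(hasLaw_apply_of_pyrPi hW _).map_eq]
  exact hW.map_eq

end

/-- The bases and the remainder of the decomposition of a trace, if it has `k` letters `a`. -/
theorem exists_leftInverse_pyrMap (hrefl : ∀ a, R a a) (hsymm : ∀ a b, R a b → R b a)
    (a : α) (k : ℕ) : ∃ D : TraceMonoid R → Fin (k + 1) → TraceMonoid R,
      ∀ w : Fin (k + 1) → TraceMonoid R,
        IsPyrBase a (fun i : Fin k => w i.castSucc) (w (Fin.last k)) → D (pyrMap a w) = w := by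
  have hinj : Set.InjOn (pyrMap a) {w : Fin (k + 1) → TraceMonoid R |
      IsPyrBase a (fun i : Fin k => w i.castSucc) (w (Fin.last k))} := by
    intro w hw w' hw' h
    obtain ⟨h1, h2⟩ := pyrProd_inj hrefl hsymm hw hw' h
    exact funext (Fin.lastCases h2 fun i => congrFun h1 i)
  exact ⟨Function.invFunOn (pyrMap a) _, fun w hw => hinj.leftInvOn_invFunOn hw⟩

variable [Fintype α]

theorem measure_occ_eq {Ω : Type*} [MeasurableSpace Ω] {P : Measure Ω} {ξ : Ω → TraceMonoid R}
    {a : α} {k : ℕ} {m mL mT : Measure (TraceMonoid R)} [IsProbabilityMeasure mL]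
    [IsProbabilityMeasure mT] {c : ℝ≥0∞} (hlaw : HasLaw ξ m P)
    (hm : m.restrict {x | occ R a x = k} = c • (pyrPi mL mT k).map (pyrMap a)) :
    P {ω | occ R a (ξ ω) = k} = c := by
  rw [hlaw.measure_eq (p := fun x => occ R a x = k) MeasurableSet.of_discrete,
    ← Measure.restrict_apply_univ, hm, Measure.smul_apply,
    Measure.map_apply Measurable.of_discrete MeasurableSet.univ]
  simp

/-- The joint law of the bases and the remainder, given that there are `k` letters `a`. -/
theorem hasLaw_pyrPi_of_hasLaw (hrefl : ∀ a, R a a) (hsymm : ∀ a b, R a b → R b a)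
    {Ω : Type*} [MeasurableSpace Ω] {P : Measure Ω} {ξ : Ω → TraceMonoid R} (hξ : Measurable ξ)
    {a : α} {k : ℕ} {m mL mT : Measure (TraceMonoid R)} [IsProbabilityMeasure mL]
    [IsProbabilityMeasure mT] {c : ℝ≥0∞} (hc0 : c ≠ 0) (hct : c ≠ ∞) (hlaw : HasLaw ξ m P)
    (hL : ∀ v, ¬ (a ∉ supp v ∧ MaxIn R (link R a) v) → mL {v} = 0)
    (hT : ∀ u, a ∈ supp u → mT {u} = 0)
    (hm : m.restrict {x | occ R a x = k} = c • (pyrPi mL mT k).map (pyrMap a))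
    {W : Ω → Fin (k + 1) → TraceMonoid R}
    (hW : ∀ ω, occ R a (ξ ω) = k →
      IsPyrBase a (fun i : Fin k => W ω i.castSucc) (W ω (Fin.last k)) ∧ pyrMap a (W ω) = ξ ω) :
    HasLaw W (pyrPi mL mT k) P[|{ω | occ R a (ξ ω) = k}] := by
  obtain ⟨D, hD⟩ := exists_leftInverse_pyrMap hrefl hsymm a k
  have hP := measure_occ_eq hlaw hm
  have hmeas : MeasurableSet {ω | occ R a (ξ ω) = k} :=
    hξ (MeasurableSet.of_discrete (s := {x | occ R a x = k}))
  -- `W` is not assumed measurable; on the event it is a function of `ξ`, which gives its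
  -- measurability almost everywhere and its law.
  have hWD : W =ᵐ[P[|{ω | occ R a (ξ ω) = k}]] D ∘ ξ := by
    filter_upwards [ae_cond_mem hmeas] with ω hω
    obtain ⟨h1, h2⟩ := hW ω hω
    rw [Function.comp_apply, ← h2, hD _ h1]
  have hDξ : Measurable (D ∘ ξ) := Measurable.of_discrete.comp hξ
  refine ⟨hDξ.aemeasurable.congr hWD.symm, ?_⟩
  have hmap : P[|{ω | occ R a (ξ ω) = k}].map ξ = (pyrPi mL mT k).map (pyrMap a) := by
    rw [ProbabilityTheory.cond, hP, Measure.map_smul,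
      show {ω | occ R a (ξ ω) = k} = ξ ⁻¹' {x | occ R a x = k} from rfl,
      ← Measure.restrict_map hξ MeasurableSet.of_discrete, hlaw.map_eq, hm, smul_smul,
      ENNReal.inv_mul_cancel hc0 hct, one_smul]
  rw [Measure.map_congr hWD, ← Measure.map_map Measurable.of_discrete hξ, hmap,
    Measure.map_map Measurable.of_discrete Measurable.of_discrete]
  have hid : D ∘ pyrMap a =ᵐ[pyrPi mL mT k] id := by
    filter_upwards [ae_isPyrBase hL hT k] with w hw
    exact hD w hw
  rw [Measure.map_congr hid, Measure.map_id]

theorem condMeasure_link_eq_zero (hrefl : ∀ a, R a a) (hsymm : ∀ a b, R a b → R b a) {a : α}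
    {p : ℝ} (hp0 : 0 ≤ p) (hp : ENNReal.ofReal p < smallestRoot R {a}ᶜ) (v : TraceMonoid R)
    (hv : ¬ (a ∉ supp v ∧ MaxIn R (link R a) v)) :
    condMeasure R {a}ᶜ p (link R a) {v} = 0 := by
  rw [condMeasure_eq hrefl hsymm _ hp0 hp, Measure.smul_apply, rawMeasure_link_eq_zero v hv,
    smul_zero]

theorem condMeasure_compl_eq_zero (hrefl : ∀ a, R a a) (hsymm : ∀ a b, R a b → R b a) {a : α}
    (T : Set α) {p : ℝ} (hp0 : 0 ≤ p) (hp : ENNReal.ofReal p < smallestRoot R {a}ᶜ)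
    (u : TraceMonoid R) (hu : a ∈ supp u) : condMeasure R {a}ᶜ p T {u} = 0 := by
  rw [condMeasure_eq hrefl hsymm _ hp0 hp, Measure.smul_apply, rawMeasure_compl_eq_zero u hu,
    smul_zero]

/-- The laws of the factors of a random trace, given the number of letters `a`. -/
theorem laws_of_isPyrDecomp (hrefl : ∀ a, R a a) (hsymm : ∀ a b, R a b → R b a)
    {Ω : Type*} [MeasurableSpace Ω] {P : Measure Ω} [IsProbabilityMeasure P]
    {ξ : Ω → TraceMonoid R} (hξ : Measurable ξ)
    {a : α} {k : ℕ} {m mL mT : Measure (TraceMonoid R)} [IsProbabilityMeasure mL]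
    [IsProbabilityMeasure mT] {c : ℝ≥0∞} (hc0 : c ≠ 0) (hct : c ≠ ∞) (hlaw : HasLaw ξ m P)
    (hL : ∀ v, ¬ (a ∉ supp v ∧ MaxIn R (link R a) v) → mL {v} = 0)
    (hT : ∀ u, a ∈ supp u → mT {u} = 0)
    (hm : m.restrict {x | occ R a x = k} = c • (pyrPi mL mT k).map (pyrMap a))
    {U V : ℕ → Ω → TraceMonoid R}
    (hU : ∀ ω, occ R a (ξ ω) = k → IsPyrDecomp R a (ξ ω) k (fun i => U i ω))
    (hV : ∀ ω, occ R a (ξ ω) = k → ∀ i < k, U i ω = V i ω * letter R a) :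
    iIndepFun (fun i : Fin (k + 1) => U i) P[|{ω | occ R a (ξ ω) = k}] ∧
    (∀ i < k, ∀ j < k, IdentDistrib (U i) (U j)
      P[|{ω | occ R a (ξ ω) = k}] P[|{ω | occ R a (ξ ω) = k}]) ∧
    (∀ i < k, HasLaw (V i) mL P[|{ω | occ R a (ξ ω) = k}]) ∧
    HasLaw (U k) mT P[|{ω | occ R a (ξ ω) = k}] := by
  have hP : P {ω | occ R a (ξ ω) = k} ≠ 0 := by rwa [measure_occ_eq hlaw hm]
  have hmeas : MeasurableSet {ω | occ R a (ξ ω) = k} :=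
    hξ (MeasurableSet.of_discrete (s := {x | occ R a x = k}))
  have hprob := cond_isProbabilityMeasure hP
  have hmem := ae_cond_mem (μ := P) hmeas
  let W : Ω → Fin (k + 1) → TraceMonoid R := fun ω =>
    Fin.snoc (α := fun _ => TraceMonoid R) (fun i : Fin k => V i ω) (U k ω)
  have hW : HasLaw W (pyrPi mL mT k) P[|{ω | occ R a (ξ ω) = k}] := by
    refine hasLaw_pyrPi_of_hasLaw hrefl hsymm hξ hc0 hct hlaw hL hT hm fun ω hω => ?_
    obtain ⟨v, h1, h2, h3⟩ := (isPyrDecomp_iff hrefl hsymm).1 (hU ω hω)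
    -- Right cancellation of the apex identifies the bases.
    have hv : v = fun i : Fin k => V i ω := by
      funext i
      exact mul_right_cancel_trace hrefl hsymm ((h2 i).symm.trans (hV ω hω i i.2))
    subst hv
    simpa [W, pyrMap] using And.intro h1 h3
  have hVlaw : ∀ i < k, HasLaw (V i) mL P[|{ω | occ R a (ξ ω) = k}] := by
    intro i hi
    have h := hasLaw_apply_of_pyrPi hW (Fin.castSucc ⟨i, hi⟩)
    simpa only [W, Fin.snoc_castSucc] using h
  have hUV : ∀ i < k, U i =ᵐ[P[|{ω | occ R a (ξ ω) = k}]] fun ω => V i ω * letter R a := by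
    intro i hi
    filter_upwards [hmem] with ω hω
    exact hV ω hω i hi
  have hUlaw : ∀ i < k, AEMeasurable (U i) P[|{ω | occ R a (ξ ω) = k}] ∧
      P[|{ω | occ R a (ξ ω) = k}].map (U i) = mL.map (· * letter R a) := by
    intro i hi
    have h1 : Measurable fun x : TraceMonoid R => x * letter R a := Measurable.of_discrete
    refine ⟨(h1.comp_aemeasurable (hVlaw i hi).aemeasurable).congr (hUV i hi).symm, ?_⟩
    rw [Measure.map_congr (hUV i hi), ← (hVlaw i hi).map_eq,
      AEMeasurable.map_map_of_aemeasurable h1.aemeasurable (hVlaw i hi).aemeasurable]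
    rfl
  refine ⟨?_, fun i hi j hj => ⟨(hUlaw i hi).1, (hUlaw j hj).1, ?_⟩, hVlaw, ?_⟩
  -- The apex is put back on every coordinate but the last, which preserves independence.
  · have hind := (iIndepFun_of_pyrPi hW).comp
      (fun i x => if i = Fin.last k then x else x * letter R a) fun _ => Measurable.of_discrete
    refine hind.congr (Fin.lastCases ?_ fun i => ?_)
    · refine Filter.Eventually.of_forall fun ω => ?_
      simp [W]
    · filter_upwards [hUV i i.2] with ω hω
      simp [W, hω, (Fin.castSucc_lt_last i).ne]
  · rw [(hUlaw i hi).2, (hUlaw j hj).2]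
  · have h := hasLaw_apply_of_pyrPi hW (Fin.last k)
    simpa only [W, Fin.snoc_last] using h

/-- A random trace obtained as a product of independent factors, in random number. -/
theorem hasLaw_pyrProd {Ω : Type*} [MeasurableSpace Ω] {P : Measure Ω} [IsProbabilityMeasure P]
    {K : Ω → ℕ} {V : ℕ → Ω → TraceMonoid R} {U : Ω → TraceMonoid R} (hK : Measurable K) {a : α}
    {m mL mT : Measure (TraceMonoid R)} [IsProbabilityMeasure mL]
    [IsProbabilityMeasure mT] {c : ℕ → ℝ≥0∞} (hc0 : ∀ k, c k ≠ 0)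
    (hm : ∀ k, m.restrict {x | occ R a x = k} = c k • (pyrPi mL mT k).map (pyrMap a))
    (hP : ∀ k, P {ω | K ω = k} = c k)
    (hind : ∀ k : ℕ,
      iIndepFun (Fin.snoc (α := fun _ => Ω → TraceMonoid R) (fun i : Fin k => V i) U)
        P[|{ω | K ω = k}])
    (hU : ∀ k : ℕ, HasLaw U mT P[|{ω | K ω = k}])
    (hV : ∀ k : ℕ, ∀ i < k, HasLaw (V i) mL P[|{ω | K ω = k}]) :
    HasLaw (fun ω => ((List.range (K ω)).map fun i => V i ω * letter R a).prod * U ω) m P := by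
  set X : Ω → TraceMonoid R :=
    fun ω => ((List.range (K ω)).map fun i => V i ω * letter R a).prod * U ω with hX
  have hmeas : ∀ k, MeasurableSet {ω | K ω = k} := fun k => hK (measurableSet_singleton k)
  have hlaw : ∀ k, HasLaw X ((pyrPi mL mT k).map (pyrMap a)) P[|{ω | K ω = k}] := by
    intro k
    have hprob : IsProbabilityMeasure P[|{ω | K ω = k}] :=
      cond_isProbabilityMeasure (by rw [hP]; exact hc0 k)
    let W : Ω → Fin (k + 1) → TraceMonoid R := fun ω i =>
      Fin.snoc (α := fun _ => Ω → TraceMonoid R) (fun i : Fin k => V i) U i ω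
    have hW : HasLaw W (pyrPi mL mT k) P[|{ω | K ω = k}] := by
      refine hasLaw_pyrPi_of_iIndepFun (hind k) (Fin.lastCases ?_ fun i => ?_)
      · simpa only [W, Fin.snoc_last] using hU k
      · simpa only [W, Fin.snoc_castSucc] using hV k i i.2
    have hXW : X =ᵐ[P[|{ω | K ω = k}]] fun ω => pyrMap a (W ω) := by
      filter_upwards [ae_cond_mem (hmeas k)] with ω hω
      have hω' : K ω = k := hω
      simp only [hX, hω', pyrMap, pyrProd, W, Fin.snoc_last, Fin.snoc_castSucc]
      congr 2
      refine List.ext_getElem (by simp) fun n h1 h2 => by simp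
    have h1 : Measurable (pyrMap (R := R) a (k := k)) := Measurable.of_discrete
    refine ⟨(h1.comp_aemeasurable hW.aemeasurable).congr hXW.symm, ?_⟩
    rw [Measure.map_congr hXW, ← hW.map_eq,
      AEMeasurable.map_map_of_aemeasurable h1.aemeasurable hW.aemeasurable]
    rfl
  have hrestrict : ∀ k, P.restrict {ω | K ω = k} = c k • P[|{ω | K ω = k}] := by
    intro k
    rw [ProbabilityTheory.cond, hP, smul_smul, ENNReal.mul_inv_cancel (hc0 k), one_smul]
    rw [← hP]
    exact measure_ne_top _ _
  -- The factors are only known to be measurable almost everywhere under each conditional law, so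
  -- measurability is glued over the countably many values of `K`.
  have hXm : AEMeasurable X (Measure.sum fun k => P.restrict {ω | K ω = k}) := by
    refine aemeasurable_sum_measure_iff.2 fun k => ?_
    rw [hrestrict]
    exact (hlaw k).aemeasurable.smul_measure _
  refine ⟨by rwa [sum_restrict_fiber P hK] at hXm, ?_⟩
  rw [← sum_restrict_fiber P hK, Measure.map_sum hXm,
    ← sum_restrict_fiber m (Measurable.of_discrete (f := occ R a))]
  congr 1
  funext k
  rw [hrestrict, Measure.map_smul, (hlaw k).map_eq, hm k]

end Laws

end TraceMonoid
-- The theorem: identification of `r`, decomposition and reconstruction.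
open TraceMonoid in
theorem proposition2 {α : Type*} [Fintype α] (R : α → α → Prop)
    (hrefl : ∀ a, R a a) (hsymm : ∀ a b, R a b → R b a)
    (T : Set α) (a : α) (ha : a ∈ T)
    (p : ℝ) (hp0 : 0 < p) (hp : ENNReal.ofReal p < smallestRoot R Set.univ)
    (r : ℝ) (hr : r = 1 - mobiusAt R Set.univ p / mobiusAt R {a}ᶜ p) :
    -- the parameters are admissible
    ENNReal.ofReal p < smallestRoot R {a}ᶜ ∧
    IsProbabilityMeasure (multMeasure R {a}ᶜ p) ∧
    r ∈ Set.Ioo 0 1 ∧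
    r = (multMeasure R Set.univ p).real {x | 0 < occ R a x} ∧
    -- the decomposition into pyramidal factors and a remainder is well defined
    (∀ x : TraceMonoid R, ∃! u, IsPyrDecomp R a x (occ R a x) u) ∧
    (∀ u ∈ pyr R a, ∃! v, v ∈ sub R {a}ᶜ ∧ u = v * letter R a) ∧
    -- the laws of the decomposition of a random trace
    (∀ (Ω : Type*) [MeasurableSpace Ω] (P : Measure Ω) [IsProbabilityMeasure P]
      (ξ : Ω → TraceMonoid R) (K : Ω → ℕ) (U V : ℕ → Ω → TraceMonoid R),
      Measurable ξ → HasLaw ξ (condMeasure R Set.univ p T) P →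
      (∀ ω, K ω = occ R a (ξ ω)) →
      (∀ ω, IsPyrDecomp R a (ξ ω) (K ω) (fun i => U i ω)) →
      (∀ ω, ∀ i < K ω, V i ω ∈ sub R {a}ᶜ ∧ U i ω = V i ω * letter R a) →
      (∀ k : ℕ, P.real {ω | K ω = k} = (1 - r) * r ^ k) ∧
      ∀ k : ℕ,
        iIndepFun (fun i : Fin (k + 1) => U i) P[|{ω | K ω = k}] ∧
        (∀ i < k, ∀ j < k,
          IdentDistrib (U i) (U j) P[|{ω | K ω = k}] P[|{ω | K ω = k}]) ∧
        (∀ i < k, HasLaw (V i) (condMeasure R {a}ᶜ p (link R a)) P[|{ω | K ω = k}]) ∧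
        HasLaw (U k) (condMeasure R {a}ᶜ p T) P[|{ω | K ω = k}]) ∧
    -- the reconstruction of a random trace
    (∀ (Ω : Type*) [MeasurableSpace Ω] (P : Measure Ω) [IsProbabilityMeasure P]
      (K : Ω → ℕ) (V : ℕ → Ω → TraceMonoid R) (U : Ω → TraceMonoid R),
      Measurable K →
      (∀ k : ℕ, P.real {ω | K ω = k} = (1 - r) * r ^ k) →
      (∀ k : ℕ,
        iIndepFun (Fin.snoc (α := fun _ => Ω → TraceMonoid R) (fun i : Fin k => V i) U)
          P[|{ω | K ω = k}] ∧
        HasLaw U (condMeasure R {a}ᶜ p T) P[|{ω | K ω = k}] ∧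
        ∀ i < k, HasLaw (V i) (condMeasure R {a}ᶜ p (link R a)) P[|{ω | K ω = k}]) →
      HasLaw
        (fun ω => ((List.range (K ω)).map fun i => V i ω * letter R a).prod * U ω)
        (condMeasure R Set.univ p T) P) := by
  have hp' := hp.trans_le (smallestRoot_univ_le hrefl hsymm {a}ᶜ)
  obtain ⟨hlt, hmass⟩ := pyrMass_eq hrefl hsymm (a := a) hp0.le hp
  have hr' : r = (pyrMass R a p).toReal := hr.trans hmass
  have hpos := pyrMass_pos (R := R) (a := a) hp0
  have hr0 : 0 < r := hr' ▸ ENNReal.toReal_pos hpos.ne' hlt.ne_top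
  have hr1 : r < 1 := by
    have := (ENNReal.toReal_lt_toReal hlt.ne_top ENNReal.one_ne_top).2 hlt
    rwa [← hr', ENNReal.toReal_one] at this
  have hmL := isProbabilityMeasure_condMeasure hrefl hsymm (link R a) hp0.le hp'
  have hmT := isProbabilityMeasure_condMeasure hrefl hsymm T hp0.le hp'
  have hrestrict := condMeasure_restrict_occ hrefl hsymm ha hp0.le hp
  have hc : ∀ k : ℕ, ((1 - pyrMass R a p) * pyrMass R a p ^ k).toReal = (1 - r) * r ^ k := by
    intro k
    rw [ENNReal.toReal_mul, ENNReal.toReal_pow,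
      ENNReal.toReal_sub_of_le hlt.le ENNReal.one_ne_top, ENNReal.toReal_one, hr']
  have hc0 : ∀ k : ℕ, (1 - pyrMass R a p) * pyrMass R a p ^ k ≠ 0 := fun k =>
    mul_ne_zero (tsub_pos_of_lt hlt).ne' (pow_ne_zero k hpos.ne')
  have hct : ∀ k : ℕ, (1 - pyrMass R a p) * pyrMass R a p ^ k ≠ ∞ := fun k =>
    ENNReal.mul_ne_top (ENNReal.sub_ne_top ENNReal.one_ne_top) (ENNReal.pow_ne_top hlt.ne_top)
  refine ⟨hp', isProbabilityMeasure_multMeasure hrefl hsymm hp0.le hp', ⟨hr0, hr1⟩, ?_,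
    existsUnique_isPyrDecomp hrefl hsymm a,
    fun u hu => existsUnique_eq_mul_letter_of_mem_pyr hrefl hsymm hu, ?_, ?_⟩
  · have := isProbabilityMeasure_multMeasure hrefl hsymm hp0.le hp
    have hmu := mobiusAt_pos hrefl hsymm hp0.le hp
    have hmu' := mobiusAt_pos hrefl hsymm hp0.le hp'
    -- The complement consists of the traces on `Σ'`, of total weight `1 / μ_Σ'(p)`, hence of
    -- probability `μ_Σ(p) / μ_Σ'(p)`.
    have hcompl : {x : TraceMonoid R | 0 < occ R a x} = {x | occ R a x = 0}ᶜ := by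
      ext x
      simp [Nat.pos_iff_ne_zero]
    rw [hcompl, probReal_compl_eq_one_sub MeasurableSet.of_discrete, measureReal_def,
      multMeasure_eq _ hp0.le hmu.le, Measure.smul_apply,
      rawMeasure_occ_eq hrefl hsymm (Set.mem_univ a) hp0.le hp',
      rawMeasure_univ_eq_inv hrefl hsymm hp0.le hp', pow_zero, one_mul, smul_eq_mul,
      ENNReal.toReal_mul, ENNReal.toReal_inv, ENNReal.toReal_ofReal hmu.le,
      ENNReal.toReal_ofReal hmu'.le, hr, div_eq_mul_inv]
  · intro Ω _ P _ ξ K U V hξ hlaw hK hU hV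
    obtain rfl : K = fun ω => occ R a (ξ ω) := funext hK
    refine ⟨fun k => ?_, fun k => ?_⟩
    · rw [measureReal_def, measure_occ_eq hlaw (hrestrict k), hc]
    · exact laws_of_isPyrDecomp hrefl hsymm hξ (hc0 k) (hct k) hlaw
        (condMeasure_link_eq_zero hrefl hsymm hp0.le hp')
        (condMeasure_compl_eq_zero hrefl hsymm T hp0.le hp') (hrestrict k)
        (fun ω hω => hω ▸ hU ω) fun ω hω i hi => (hV ω i (hi.trans_eq hω.symm)).2
  · intro Ω _ P _ K V U hK hPK h
    refine hasLaw_pyrProd hK hc0 hrestrict (fun k => ?_) (fun k => (h k).1)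
      (fun k => (h k).2.1) fun k => (h k).2.2
    rw [← ENNReal.toReal_eq_toReal_iff' (measure_ne_top _ _) (hct k), hc, ← hPK k]
    rfl
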